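/- The Selberg class $\mathcal S$ is the set of Dirichlet series $F(s)=\sum_{n\ge1}a_n n^{-s}$ such that: (1) $(s-1)^mF(s)$ continues to an entire function of finite order for some integer $m\ge0$; (2) $a_n\ll_\varepsilon n^\varepsilon$ for every $\varepsilon>0$; (3) there is a function $\gamma_F(s)=\epsilon Q^s\prod_{i=1}^k\Gamma(w_is+\mu_i)$ with $k\ge0$, $|\epsilon|=1$, $Q>0$, $w_i>0$ and $\Re\mu_i\ge0$ such that $\Phi=\gamma_FF$ satisfies $\Phi(s)=\overline{\Phi(1-\bar s)}$ as meromorphic functions; (4) $a_1=1$ and $\log F(s)=\sum_{n\ge1}b_nn^{-s}$ for $\Re s>1$, where $b_n=0$ unless $n$ is a positive power of a prime, and $b_n\ll n^\theta$ for some $\theta<1/2$. Call $F\in\mathcal S$ primitive if $F\ne1$ and $F=F_1F_2$ with $F_1,F_2\in\mathcal S$ implies $F_1=1$ or $F_2=1$. For $F \in \mathcal S$ and an integer $n$, write $n_F=n$ if $\sum_{p\le x}|a_p|^2/p=n\log\log x+O(1)$ as $x\to\infty$, the sum being over primes $p$. Assume Selberg's conjectures: (i) (regularity of distribution) for every $F\in\mathcal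 S$ there is an integer $n_F$ such that $\sum_{p\le x}|a_p|^2/p=n_F\log\log x+O(1)$ as $x\to\infty$; (ii) (orthonormality) if $F=\sum a_nn^{-s}$ and $F'=\sum a'_nn^{-s}$ are distinct primitive elements of $\mathcal S$, then $n_F=1$ and $\sum_{p\le x}a_p\overline{a'_p}/p=O(1)$ as $x\to\infty$. Then every $F\in\mathcal S$ with $n_F=1$ is primitive. -/

import Mathlib

open Filter Asymptotics
open scoped ComplexConjugate

namespace Selberg

/-! A Dirichlet series `∑ aₙ n⁻ˢ` is represented by its coefficient sequence, an
`ArithmeticFunction ℂ` (so `a 0 = 0`). The product is Dirichlet convolution, i.e. the product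
of Dirichlet series, and `1` is the constant series `1`. Its sum is Mathlib's `LSeries`. -/

/-- `|E(s)| ≪ exp(|s|^ρ)` as `|s| → ∞`, for some real `ρ`. -/
def HasFiniteOrder (E : ℂ → ℂ) : Prop :=
  ∃ ρ : ℝ, E =O[Bornology.cobounded ℂ] fun s => Real.exp (‖s‖ ^ ρ)

/-- `(s - 1) ^ m * F s` is an entire function of finite order for some `m ≥ 0`. (The value of `F`
at the possible pole `s = 1` carries no information.) -/
def IsAnalyticAwayFromOne (F : ℂ → ℂ) : Prop :=
  ∃ (m : ℕ) (E : ℂ → ℂ), Differentiable ℂ E ∧ HasFiniteOrder E ∧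
    ∀ s : ℂ, s ≠ 1 → E s = (s - 1) ^ m * F s

/-- `γ(s) = ε Q^s ∏ᵢ Γ(wᵢ s + μᵢ)`. -/
noncomputable def gammaFactor (ε : ℂ) (Q : ℝ) {k : ℕ} (w : Fin k → ℝ) (μ : Fin k → ℂ)
    (s : ℂ) : ℂ :=
  ε * (Q : ℂ) ^ s * ∏ i, Complex.Gamma (w i * s + μ i)

/-- `s` is a regular point of `γ(s) F(s)`: no gamma function has a pole there, and `s ≠ 1`. -/
def IsRegularPoint {k : ℕ} (w : Fin k → ℝ) (μ : Fin k → ℂ) (s : ℂ) : Prop :=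
  s ≠ 1 ∧ ∀ (i : Fin k) (n : ℕ), (w i : ℂ) * s + μ i ≠ -(n : ℂ)

/-- `Φ(s) = γ(s) F(s)` satisfies `Φ(s) = conj Φ(1 - conj s)` for some admissible `γ`, at all `s`
where neither side has a possible pole. -/
def HasFunctionalEquation (F : ℂ → ℂ) : Prop :=
  ∃ (ε : ℂ) (Q : ℝ) (k : ℕ) (w : Fin k → ℝ) (μ : Fin k → ℂ),
    ‖ε‖ = 1 ∧ 0 < Q ∧ (∀ i, 0 < w i) ∧ (∀ i, 0 ≤ (μ i).re) ∧
    ∀ s : ℂ, IsRegularPoint w μ s → IsRegularPoint w μ (1 - conj s) →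
      gammaFactor ε Q w μ s * F s =
        conj (gammaFactor ε Q w μ (1 - conj s) * F (1 - conj s))

/-- `aₙ ≪ n^ε` for every fixed `ε > 0`. -/
def RamanujanBound (a : ArithmeticFunction ℂ) : Prop :=
  ∀ ε : ℝ, 0 < ε → (fun n : ℕ => a n) =O[atTop] fun n : ℕ => (n : ℝ) ^ ε

/-- `a₁ = 1` and `log F(s) = ∑ bₙ n⁻ˢ` for `Re s > 1`, with `b` supported on the positive powers
of primes and `bₙ ≪ n^θ` for some `θ < 1/2`. -/
def HasEulerProduct (a : ArithmeticFunction ℂ) : Prop :=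
  a 1 = 1 ∧ ∃ b : ℕ → ℂ,
    (∀ n, ¬ IsPrimePow n → b n = 0) ∧
    (∃ θ : ℝ, θ < 1 / 2 ∧ b =O[atTop] fun n : ℕ => (n : ℝ) ^ θ) ∧
    ∀ s : ℂ, 1 < s.re → LSeriesSummable b s ∧ Complex.exp (LSeries b s) = LSeries (fun n => a n) s

/-- The Selberg class. -/
def selbergClass : Set (ArithmeticFunction ℂ) :=
  {a | RamanujanBound a ∧ HasEulerProduct a ∧
    ∃ F : ℂ → ℂ, (∀ s : ℂ, 1 < s.re → F s = LSeries (fun n => a n) s) ∧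
      IsAnalyticAwayFromOne F ∧ HasFunctionalEquation F}

/-- The primitive elements of the Selberg class; the unit `1` is not counted as primitive. -/
def IsPrimitive (F : ArithmeticFunction ℂ) : Prop :=
  F ∈ selbergClass ∧ F ≠ 1 ∧
    ∀ F₁ ∈ selbergClass, ∀ F₂ ∈ selbergClass, F = F₁ * F₂ → F₁ = 1 ∨ F₂ = 1

/-- `n_F = n`, that is, `∑_{p ≤ x} |a_p|² / p = n log log x + O(1)` as `x → ∞`. -/
def HasPrimeDensity (F : ArithmeticFunction ℂ) (n : ℤ) : Prop :=
  (fun x : ℝ => (∑ p ∈ Finset.range (⌊x⌋₊ + 1) with p.Prime, ‖F p‖ ^ 2 / (p : ℝ))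
      - (n : ℝ) * Real.log (Real.log x)) =O[atTop] fun _ => (1 : ℝ)

/-- Selberg's regularity of distribution conjecture. -/
def RegularityConjecture : Prop :=
  ∀ F ∈ selbergClass, ∃ n : ℤ, HasPrimeDensity F n

/-- Selberg's orthonormality conjecture: if `F` and `F'` are distinct and primitive, then `n_F = 1`
and `∑_{p ≤ x} a_p conj(a'_p) / p = O(1)` as `x → ∞`. -/
def OrthonormalityConjecture : Prop :=
  ∀ F F' : ArithmeticFunction ℂ, IsPrimitive F → IsPrimitive F' → F ≠ F' →
    HasPrimeDensity F 1 ∧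
    (fun x : ℝ => ∑ p ∈ Finset.range (⌊x⌋₊ + 1) with p.Prime, F p * conj (F' p) / (p : ℂ))
      =O[atTop] fun _ => (1 : ℝ)

end Selberg

/-! Factor `F` into primitive elements `P₁ ⋯ P_k`; this is possible because `F ≠ 1`, the constant
series having prime density `0`. At a prime the coefficient of a product is the sum of the
coefficients, so the sum of `|a_p|² / p` splits into the pairings of `Pᵢ` with `Pⱼ`. The pairs with
`Pᵢ ≠ Pⱼ` contribute `O(1)`, and comparing coefficients of `log log x` gives `1 = ∑ n_{Pᵢ}` over the
pairs with `Pᵢ = Pⱼ`. If all the factors coincide this reads `1 = k² n_P`; otherwise every `n_{Pᵢ}`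
is `1` and the diagonal alone contributes `k`. Either way `k = 1`
(`card_eq_one_of_hasPrimeDensity_one`).

Most of the work lies in the existence of the factorization, by induction on the degree. The degree
`2 ∑ wᵢ` is recovered from the growth of `F` on the lines `Re s = -c` as `c → ∞`, so it depends on
`F` alone and is additive. The induction stops because a nontrivial element has degree at least `1`
(`eq_one_or_exists_hasLeftGrowth`).

For this gap, let the degree be `d < 1`. Moving a smoothed coefficient integral to `Re s = -c` gives
`aₙ ≪ n^(dc + O(1) - c)` with the `O(1)` independent of `c`, so the series converges absolutely
everywhere. It is then bounded on vertical lines, which forces `d = 0` and leaves no gamma factors.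
The functional equation now makes `F` a Dirichlet polynomial, and comparing both sides far to the
left gives `|a_N| = N^(1/2)` for the last coefficient. The Euler product gives `|a_N| ≤ N^θ` with `θ
< 1/2`, because the local polynomials have no zeros of modulus less than `p^(-θ)`. Hence `N = 1` and
`F = 1`. -/

namespace Selberg

/-! ### Gamma quotients on vertical lines, without Stirling's formula -/

open Complex in
lemma norm_betaIntegral_le {x θ : ℝ} {z : ℂ} (hz : z.re = x) :
    ‖betaIntegral z θ‖ ≤ ∫ t in (0 : ℝ)..1, t ^ (x - 1) * ‖(1 - (t : ℂ)) ^ ((θ : ℂ) - 1)‖ := by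
  refine (intervalIntegral.norm_integral_le_integral_norm zero_le_one).trans_eq ?_
  refine intervalIntegral.integral_congr_ae (Eventually.of_forall fun t ht => ?_)
  rw [Set.uIoc_of_le zero_le_one] at ht
  rw [norm_mul, norm_cpow_eq_rpow_re_of_pos ht.1]
  simp [hz]

/-- `Γ(z) Γ(θ) = Γ(z + θ) B(z, θ)`, and the beta integral is bounded in terms of `Re z` and `θ`
only. The identity needs `θ > 0`, so `θ = 0` is treated apart. -/
lemma exists_norm_Gamma_le_of_re_pos {x θ : ℝ} (hx : 0 < x) (hθ : 0 ≤ θ) :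
    ∃ C > 0, ∀ z : ℂ, z.re = x → ‖Complex.Gamma z‖ ≤ C * ‖Complex.Gamma (z + θ)‖ := by
  rcases hθ.eq_or_lt with rfl | hθ
  · exact ⟨1, one_pos, fun z _ => by simp⟩
  set B := ∫ t in (0 : ℝ)..1, t ^ (x - 1) * ‖(1 - (t : ℂ)) ^ ((θ : ℂ) - 1)‖ with hB
  have hB0 : 0 ≤ B := intervalIntegral.integral_nonneg zero_le_one fun t ht =>
    mul_nonneg (Real.rpow_nonneg ht.1 _) (norm_nonneg _)
  have hG := Real.Gamma_pos_of_pos hθ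
  refine ⟨(B + 1) / Real.Gamma θ, by positivity, fun z hz => ?_⟩
  have h := congrArg norm (Complex.Gamma_mul_Gamma_eq_betaIntegral (s := z) (t := θ)
    (by rw [hz]; exact hx) (by simpa using hθ))
  rw [norm_mul, norm_mul, Complex.Gamma_ofReal, Complex.norm_real, Real.norm_of_nonneg hG.le] at h
  rw [div_mul_eq_mul_div, le_div_iff₀ hG, h, mul_comm]
  gcongr
  linarith [norm_betaIntegral_le (θ := θ) hz]

lemma ne_zero_of_one_le_abs_im {z : ℂ} (h : 1 ≤ |z.im|) : z ≠ 0 := by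
  rintro rfl
  norm_num at h

lemma norm_le_of_one_le_abs_im {z : ℂ} (h : 1 ≤ |z.im|) : ‖z‖ ≤ (|z.re| + 1) * |z.im| := by
  have := Complex.norm_le_abs_re_add_abs_im z
  nlinarith [abs_nonneg z.re]

/-- On a vertical line, `Γ` is dominated by its translate to the right. -/
lemma exists_norm_Gamma_le_norm_Gamma_add (x : ℝ) {θ : ℝ} (hθ : 0 ≤ θ) :
    ∃ C > 0, ∀ z : ℂ, z.re = x → 1 ≤ |z.im| →
      ‖Complex.Gamma z‖ ≤ C * ‖Complex.Gamma (z + θ)‖ := by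
  obtain ⟨n, hn⟩ : ∃ n : ℕ, 0 < x + n := by
    obtain ⟨n, hn⟩ := exists_nat_gt (-x)
    exact ⟨n, by linarith⟩
  -- `n` counts the unit steps that bring the line into the right half plane. Each step uses `Γ(z +
  -- 1) = z Γ(z)` for `z` and for `z + θ`; the two factors have comparable size once `|Im z| ≥ 1`.
  induction n generalizing x with
  | zero =>
    obtain ⟨C, hC, h⟩ := exists_norm_Gamma_le_of_re_pos (by simpa using hn) hθ
    exact ⟨C, hC, fun z hz _ => h z hz⟩
  | succ n ih =>
    obtain ⟨C, hC, h⟩ := ih (x + 1) (by push_cast at hn; linarith)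
    refine ⟨C * (|x + θ| + 1), by positivity, fun z hz hi => ?_⟩
    have h1 := h (z + 1) (by simp [hz]) (by simpa using hi)
    have e : z + 1 + θ = (z + θ) + 1 := by ring
    have hi' : 1 ≤ |(z + θ).im| := by simpa using hi
    rw [e, Complex.Gamma_add_one z (ne_zero_of_one_le_abs_im hi),
      Complex.Gamma_add_one (z + θ) (ne_zero_of_one_le_abs_im hi'), norm_mul, norm_mul] at h1
    have h2 := norm_le_of_one_le_abs_im hi'
    have h3 := Complex.abs_im_le_norm z
    have hre : (z + θ).re = x + θ := by simp [hz]
    have him : (z + θ).im = z.im := by simp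
    rw [hre, him] at h2
    have hz0 : 0 < |z.im| := by linarith
    refine le_of_mul_le_mul_left ?_ hz0
    calc |z.im| * ‖Complex.Gamma z‖ ≤ ‖z‖ * ‖Complex.Gamma z‖ := by gcongr
      _ ≤ C * (‖z + θ‖ * ‖Complex.Gamma (z + θ)‖) := h1
      _ ≤ C * ((|x + θ| + 1) * |z.im| * ‖Complex.Gamma (z + θ)‖) := by gcongr
      _ = _ := by ring

lemma exists_norm_Gamma_add_nat_le (x : ℝ) (n : ℕ) :
    ∃ C > 0, ∀ z : ℂ, z.re = x → 1 ≤ |z.im| →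
      ‖Complex.Gamma (z + n)‖ ≤ C * |z.im| ^ n * ‖Complex.Gamma z‖ ∧
      |z.im| ^ n * ‖Complex.Gamma z‖ ≤ ‖Complex.Gamma (z + n)‖ := by
  induction n with
  | zero => exact ⟨1, one_pos, fun z _ _ => by simp⟩
  | succ n ih =>
    obtain ⟨C, hC, h⟩ := ih
    refine ⟨(|x + n| + 1) * C, by positivity, fun z hz hi => ?_⟩
    obtain ⟨h1, h2⟩ := h z hz hi
    have hi' : 1 ≤ |(z + n).im| := by simpa using hi
    have e : z + ((n + 1 : ℕ) : ℂ) = (z + n) + 1 := by push_cast; ring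
    have h3 := norm_le_of_one_le_abs_im hi'
    have h4 := Complex.abs_im_le_norm (z + n)
    have hre : (z + n).re = x + n := by simp [hz]
    have him : (z + n).im = z.im := by simp
    rw [hre, him] at h3
    rw [him] at h4
    rw [e, Complex.Gamma_add_one _ (ne_zero_of_one_le_abs_im hi'), norm_mul]
    constructor
    · calc ‖z + n‖ * ‖Complex.Gamma (z + n)‖
          ≤ ((|x + n| + 1) * |z.im|) * (C * |z.im| ^ n * ‖Complex.Gamma z‖) := by gcongr
        _ = _ := by ring
    · calc |z.im| ^ (n + 1) * ‖Complex.Gamma z‖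
          = |z.im| * (|z.im| ^ n * ‖Complex.Gamma z‖) := by ring
        _ ≤ _ := by gcongr

/-- Crude growth of a quotient of gamma functions on a vertical line. -/
lemma exists_norm_Gamma_add_bounds (x : ℝ) {δ : ℝ} (hδ : 0 ≤ δ) :
    ∃ C > 0, ∀ z : ℂ, z.re = x → 1 ≤ |z.im| →
      ‖Complex.Gamma (z + δ)‖ ≤ C * |z.im| ^ (δ + 1) * ‖Complex.Gamma z‖ ∧
      |z.im| ^ (δ - 1) * ‖Complex.Gamma z‖ ≤ C * ‖Complex.Gamma (z + δ)‖ := by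
  -- Integer shifts are controlled by the functional equation of `Γ`. Comparing `z + δ` with `z + n`
  -- and `z + n + 1` loses at most one power of `|Im z|`, whence the exponents `δ ± 1`.
  set n := ⌊δ⌋₊
  have hn : (n : ℝ) ≤ δ := Nat.floor_le hδ
  have hn' : δ < n + 1 := Nat.lt_floor_add_one δ
  obtain ⟨A, hA, h1⟩ := exists_norm_Gamma_le_norm_Gamma_add (x + δ) (θ := n + 1 - δ) (by linarith)
  obtain ⟨B, hB, h2⟩ := exists_norm_Gamma_add_nat_le x (n + 1)
  obtain ⟨D, hD, h3⟩ := exists_norm_Gamma_le_norm_Gamma_add (x + n) (θ := δ - n) (by linarith)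
  obtain ⟨E, hE, h4⟩ := exists_norm_Gamma_add_nat_le x n
  refine ⟨max (A * B) D, lt_max_of_lt_right hD, fun z hz hi => ⟨?_, ?_⟩⟩
  · have e : z + δ + ((n + 1 - δ : ℝ) : ℂ) = z + ((n + 1 : ℕ) : ℂ) := by push_cast; ring
    have k1 := h1 (z + δ) (by simp [hz]) (by simpa using hi)
    rw [e] at k1
    have k2 := (h2 z hz hi).1
    calc ‖Complex.Gamma (z + δ)‖ ≤ A * (B * |z.im| ^ (n + 1) * ‖Complex.Gamma z‖) := by
          refine k1.trans ?_
          gcongr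
      _ = A * B * |z.im| ^ ((n + 1 : ℕ) : ℝ) * ‖Complex.Gamma z‖ := by
          rw [Real.rpow_natCast]; ring
      _ ≤ _ := by
          gcongr
          · exact le_max_left _ _
          · push_cast
            linarith
  · have e : z + n + ((δ - n : ℝ) : ℂ) = z + δ := by push_cast; ring
    have k1 := h3 (z + n) (by simp [hz]) (by simpa using hi)
    rw [e] at k1
    have k2 := (h4 z hz hi).2
    calc |z.im| ^ (δ - 1) * ‖Complex.Gamma z‖ ≤ |z.im| ^ (n : ℝ) * ‖Complex.Gamma z‖ := by
          gcongr
          linarith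
      _ ≤ D * ‖Complex.Gamma (z + δ)‖ := by
          rw [Real.rpow_natCast]; exact k2.trans k1
      _ ≤ _ := by
          gcongr
          exact le_max_right _ _

end Selberg

/-! ### Growth to the left of the critical strip, from the functional equation -/

namespace Selberg

lemma norm_LSeries_le_tsum {f : ℕ → ℂ} {σ : ℝ} (hf : LSeriesSummable f σ) {s : ℂ}
    (hs : s.re = σ) : ‖LSeries f s‖ ≤ ∑' n, ‖LSeries.term f σ n‖ := by
  have h : ∀ n, ‖LSeries.term f s n‖ = ‖LSeries.term f σ n‖ := fun n => by
    simp [LSeries.norm_term_eq, hs]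
  rw [LSeries, ← tsum_congr h]
  exact norm_tsum_le_tsum_norm (by simpa only [h] using hf.norm)

lemma RamanujanBound.summable {a : ArithmeticFunction ℂ} (ha : RamanujanBound a) {s : ℂ}
    (hs : 1 < s.re) : LSeriesSummable (fun n => a n) s :=
  LSeriesSummable_of_isBigO_rpow (x := (1 + s.re) / 2) (by linarith)
    (ha ((1 + s.re) / 2 - 1) (by linarith))

/-- An element of the Selberg class is bounded above and below on vertical lines to the right
of the line `Re s = 1`. -/
lemma exists_norm_LSeries_bounds {a : ArithmeticFunction ℂ} (ha : RamanujanBound a)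
    (hE : HasEulerProduct a) {σ : ℝ} (hσ : 1 < σ) :
    ∃ M > 0, ∀ s : ℂ, s.re = σ →
      ‖LSeries (fun n => a n) s‖ ≤ M ∧ 1 ≤ M * ‖LSeries (fun n => a n) s‖ := by
  obtain ⟨-, b, -, -, hb⟩ := hE
  have hsa := ha.summable (s := σ) (by simpa using hσ)
  have hsb := (hb σ (by simpa using hσ)).1
  refine ⟨max (∑' n, ‖LSeries.term (fun n => a n) σ n‖)
    (Real.exp (∑' n, ‖LSeries.term b σ n‖)), lt_max_of_lt_right (Real.exp_pos _), fun s hs =>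
    ⟨(norm_LSeries_le_tsum hsa hs).trans (le_max_left _ _), ?_⟩⟩
  rw [← (hb s (by rw [hs]; exact hσ)).2, Complex.norm_exp]
  calc (1 : ℝ) ≤ Real.exp (∑' n, ‖LSeries.term b σ n‖) * Real.exp (LSeries b s).re := by
        rw [← Real.exp_add, Real.one_le_exp_iff]
        have h1 := norm_LSeries_le_tsum hsb hs
        have h2 := (abs_le.1 (Complex.abs_re_le_norm (LSeries b s))).1
        linarith
    _ ≤ _ := by
        gcongr
        exact le_max_right _ _

/-- `F` grows like `|t| ^ (d * c)` on the lines `Re s = -c`, up to an exponent that is bounded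
independently of `c`. -/
def HasLeftGrowth (F : ℂ → ℂ) (d : ℝ) : Prop :=
  ∃ B : ℝ, ∀ c : ℝ, 0 < c → ∃ C > 0, ∃ T : ℝ, 1 ≤ T ∧ ∀ s : ℂ, s.re = -c → T ≤ |s.im| →
    |s.im| ^ (d * c - B) ≤ C * ‖F s‖ ∧ ‖F s‖ ≤ C * |s.im| ^ (d * c + B)

lemma one_sub_conj_eq {s : ℂ} {c : ℝ} (hs : s.re = -c) :
    1 - conj s = s + ((1 + 2 * c : ℝ) : ℂ) := by
  apply Complex.ext
  · simp [hs]; ring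
  · simp

/-- On `Re s = -c` the reflection `1 - conj s` is the real translate `s + (1 + 2c)`, so the two
gamma arguments differ by the real number `w (1 + 2c)` and the translation bounds apply. -/
lemma exists_norm_Gamma_reflect_bounds {w : ℝ} (hw : 0 < w) (μ : ℂ) {c : ℝ} (hc : 0 < c) :
    ∃ C > 0, ∃ T : ℝ, 1 ≤ T ∧ ∀ s : ℂ, s.re = -c → T ≤ |s.im| →
      1 ≤ |(w * s + μ).im| ∧
      ‖Complex.Gamma (w * (1 - conj s) + μ)‖
        ≤ C * |s.im| ^ (w * (1 + 2 * c) + 1) * ‖Complex.Gamma (w * s + μ)‖ ∧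
      |s.im| ^ (w * (1 + 2 * c) - 1) * ‖Complex.Gamma (w * s + μ)‖
        ≤ C * ‖Complex.Gamma (w * (1 - conj s) + μ)‖ := by
  set δ := w * (1 + 2 * c) with hδ
  have hδ0 : 0 ≤ δ := by positivity
  obtain ⟨C, hC, h⟩ := exists_norm_Gamma_add_bounds (-(w * c) + μ.re) hδ0
  -- The first summand serves the upper bound, the second the lower one, with `|δ - 1|` covering
  -- both signs of `δ - 1`. The threshold makes `Im μ` negligible: `|Im (w s + μ)|` lies between `w
  -- |t| / 2` and `2 w |t|`, and is at least `1`.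
  refine ⟨C * (2 * w) ^ (δ + 1) + C * (w + |μ.im| + 2 * w⁻¹ + 2) ^ |δ - 1|,
    by positivity, max 1 (2 * (1 + |μ.im|) / w), le_max_left _ _, fun s hs hT => ?_⟩
  have ht1 : 1 ≤ |s.im| := (le_max_left _ _).trans hT
  have ht2 : 2 * (1 + |μ.im|) ≤ w * |s.im| := by
    have := (le_max_right _ _).trans hT
    rw [div_le_iff₀ hw] at this
    linarith
  have him : (w * s + μ).im = w * s.im + μ.im := by simp
  have hre : (w * s + μ).re = -(w * c) + μ.re := by simp [hs]
  have hm0 := abs_nonneg μ.im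
  have hup : |(w * s + μ).im| ≤ 2 * w * |s.im| := by
    rw [him]
    refine (abs_add_le _ _).trans ?_
    rw [abs_mul, abs_of_pos hw]
    linarith
  have hlo : w * |s.im| / 2 ≤ |(w * s + μ).im| := by
    rw [him]
    have := abs_sub_abs_le_abs_sub (w * s.im) (-μ.im)
    rw [abs_neg, sub_neg_eq_add, abs_mul, abs_of_pos hw] at this
    linarith
  have hi : 1 ≤ |(w * s + μ).im| := by linarith
  obtain ⟨h1, h2⟩ := h _ hre hi
  have e : (w : ℂ) * (1 - conj s) + μ = w * s + μ + δ := by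
    rw [one_sub_conj_eq hs, hδ]; push_cast; ring
  rw [← e] at h1 h2
  set y := |(w * s + μ).im|
  set t := |s.im|
  set G := ‖Complex.Gamma (w * s + μ)‖
  set G' := ‖Complex.Gamma (w * (1 - conj s) + μ)‖
  have hy : 0 < y := by linarith
  have ht : 0 < t := by linarith
  have hG : 0 ≤ G := norm_nonneg _
  have hG' : 0 ≤ G' := norm_nonneg _
  refine ⟨hi, ?_, ?_⟩
  · calc G' ≤ C * y ^ (δ + 1) * G := h1
      _ ≤ C * (2 * w * t) ^ (δ + 1) * G := by gcongr
      _ = C * (2 * w) ^ (δ + 1) * t ^ (δ + 1) * G := by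
          rw [Real.mul_rpow (by positivity) ht.le]; ring
      _ ≤ _ := by
          gcongr
          have : 0 ≤ C * (w + |μ.im| + 2 * w⁻¹ + 2) ^ |δ - 1| := by positivity
          linarith
  · set K := w + |μ.im| + 2 * w⁻¹ + 2
    have hwi : 0 < w⁻¹ := by positivity
    have hK : 1 ≤ K := by simp only [K]; linarith
    have key : t ^ (δ - 1) ≤ K ^ |δ - 1| * y ^ (δ - 1) := by
      rcases le_total 0 (δ - 1) with hd | hd
      · rw [abs_of_nonneg hd, ← Real.mul_rpow (by linarith) hy.le]
        refine Real.rpow_le_rpow ht.le ?_ hd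
        have : 2 * w⁻¹ ≤ K := by simp only [K]; linarith
        calc t = 2 * w⁻¹ * (w * t / 2) := by field_simp
          _ ≤ K * y := by gcongr
      · rw [abs_of_nonpos hd, Real.rpow_neg (by linarith), inv_mul_eq_div,
          ← Real.div_rpow hy.le (by linarith)]
        refine Real.rpow_le_rpow_of_nonpos (by positivity) ?_ hd
        rw [div_le_iff₀ (by linarith)]
        have h5 : w * t + |μ.im| ≤ (w + |μ.im|) * t := by nlinarith
        calc y ≤ w * t + |μ.im| := by
              simp only [y, him]
              refine (abs_add_le _ _).trans ?_
              rw [abs_mul, abs_of_pos hw]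
          _ ≤ (w + |μ.im|) * t := h5
          _ ≤ t * K := by
              rw [mul_comm]
              gcongr
              simp only [K]; linarith
    calc t ^ (δ - 1) * G ≤ K ^ |δ - 1| * y ^ (δ - 1) * G := by gcongr
      _ = K ^ |δ - 1| * (y ^ (δ - 1) * G) := by ring
      _ ≤ K ^ |δ - 1| * (C * G') := by gcongr
      _ = C * K ^ |δ - 1| * G' := by ring
      _ ≤ _ := by
          gcongr
          have : 0 ≤ C * (2 * w) ^ (δ + 1) := by positivity
          linarith

lemma isRegularPoint_of_im {k : ℕ} {w : Fin k → ℝ} {μ : Fin k → ℂ} {s : ℂ} (hs : s.im ≠ 0)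
    (h : ∀ i, 1 ≤ |(w i * s + μ i).im|) : IsRegularPoint w μ s := by
  refine ⟨fun h1 => hs (by simp [h1]), fun i n hn => ?_⟩
  have := h i
  rw [hn] at this
  norm_num at this

lemma norm_gammaFactor {ε : ℂ} (hε : ‖ε‖ = 1) {Q : ℝ} (hQ : 0 < Q) {k : ℕ} (w : Fin k → ℝ)
    (μ : Fin k → ℂ) (s : ℂ) :
    ‖gammaFactor ε Q w μ s‖ = Q ^ s.re * ∏ i, ‖Complex.Gamma (w i * s + μ i)‖ := by
  rw [gammaFactor, norm_mul, norm_mul, hε, one_mul, norm_prod,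
    Complex.norm_cpow_eq_rpow_re_of_pos hQ]

/-- The reflected point lies on `Re s = 1 + c`, where the series is bounded above and away from `0`,
so `|F(s)|` is the gamma quotient up to constants. Its exponents sum to `2c ∑ wᵢ + ∑ wᵢ ± k`, and
only the first term depends on `c`. -/
lemma hasLeftGrowth_of_functionalEquation {a : ArithmeticFunction ℂ} (ha : RamanujanBound a)
    (hE : HasEulerProduct a) {F : ℂ → ℂ}
    (hF : ∀ s : ℂ, 1 < s.re → F s = LSeries (fun n => a n) s)
    {ε : ℂ} {Q : ℝ} {k : ℕ} {w : Fin k → ℝ} {μ : Fin k → ℂ}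
    (hε : ‖ε‖ = 1) (hQ : 0 < Q) (hw : ∀ i, 0 < w i)
    (hfe : ∀ s : ℂ, IsRegularPoint w μ s → IsRegularPoint w μ (1 - conj s) →
      gammaFactor ε Q w μ s * F s =
        conj (gammaFactor ε Q w μ (1 - conj s) * F (1 - conj s))) :
    HasLeftGrowth F (2 * ∑ i, w i) := by
  have hW : 0 ≤ ∑ i, w i := Finset.sum_nonneg fun i _ => (hw i).le
  refine ⟨∑ i, w i + k, fun c hc => ?_⟩
  choose C hC T hT1 h using fun i => exists_norm_Gamma_reflect_bounds (hw i) (μ i) hc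
  obtain ⟨M, hM, hMb⟩ := exists_norm_LSeries_bounds ha hE (σ := 1 + c) (by linarith)
  have hP : 0 < ∏ i, C i := Finset.prod_pos fun i _ => hC i
  refine ⟨(Q ^ (1 + 2 * c) + Q ^ (-(1 + 2 * c))) * (∏ i, C i) * M, by positivity,
    1 + ∑ i, T i, le_add_of_nonneg_right (Finset.sum_nonneg fun i _ => by linarith [hT1 i]),
    fun s hs hT => ?_⟩
  have hTi : ∀ i, T i ≤ |s.im| := fun i => by
    have := Finset.single_le_sum (f := T) (fun j _ => by linarith [hT1 j]) (Finset.mem_univ i)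
    linarith
  have ht1 : 1 ≤ |s.im| := by
    have := Finset.sum_nonneg (f := T) (s := Finset.univ) (fun j _ => by linarith [hT1 j])
    linarith
  set t := |s.im|
  have ht : 0 < t := by linarith
  have h' := fun i => h i s hs (hTi i)
  set s' := 1 - conj s with hs'
  have hs're : s'.re = 1 + c := by simp [hs', hs]
  have hs'im : s'.im = s.im := by simp [hs']
  have hne : s.im ≠ 0 := fun h0 => by simp [t, h0] at ht
  have hr : IsRegularPoint w μ s := isRegularPoint_of_im hne fun i => (h' i).1
  have hr' : IsRegularPoint w μ s' := isRegularPoint_of_im (by rwa [hs'im]) fun i => by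
    have := (h' i).1
    simpa [hs'im] using this
  have hfs := congrArg norm (hfe s hr hr')
  rw [Complex.norm_conj, norm_mul, norm_mul, norm_gammaFactor hε hQ, norm_gammaFactor hε hQ,
    hs, ← hs', hs're] at hfs
  obtain ⟨hF1, hF2⟩ := hMb s' hs're
  rw [← hF s' (by rw [hs're]; linarith)] at hF1 hF2
  set P := ∏ i, ‖Complex.Gamma (w i * s + μ i)‖ with hPdef
  set P' := ∏ i, ‖Complex.Gamma (w i * s' + μ i)‖ with hP'def
  have hP0 : 0 < P := Finset.prod_pos fun i _ => norm_pos_iff.2 <|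
    Complex.Gamma_ne_zero fun m => hr.2 i m
  have hP'0 : 0 < P' := Finset.prod_pos fun i _ => norm_pos_iff.2 <|
    Complex.Gamma_ne_zero fun m => hr'.2 i m
  have up : P' ≤ (∏ i, C i) * t ^ (∑ i, (w i * (1 + 2 * c) + 1)) * P := by
    rw [Real.rpow_sum_of_pos ht, hPdef, ← Finset.prod_mul_distrib, ← Finset.prod_mul_distrib]
    exact Finset.prod_le_prod (fun i _ => norm_nonneg _) fun i _ => (h' i).2.1
  have lo : t ^ (∑ i, (w i * (1 + 2 * c) - 1)) * P ≤ (∏ i, C i) * P' := by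
    rw [Real.rpow_sum_of_pos ht, hPdef, ← Finset.prod_mul_distrib, ← Finset.prod_mul_distrib]
    exact Finset.prod_le_prod (fun i _ => by positivity) fun i _ => (h' i).2.2
  have e1 : ∑ i, (w i * (1 + 2 * c) + 1) = 2 * (∑ i, w i) * c + (∑ i, w i + k) := by
    rw [Finset.sum_add_distrib, ← Finset.sum_mul]; simp; ring
  have e2 : 2 * (∑ i, w i) * c - (∑ i, w i + k) ≤ ∑ i, (w i * (1 + 2 * c) - 1) := by
    rw [Finset.sum_sub_distrib, ← Finset.sum_mul]; simp; nlinarith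
  rw [e1] at up
  have eq1 : ‖F s‖ * P = Q ^ (1 + 2 * c) * P' * ‖F s'‖ := by
    have hq : Q ^ (1 + c) = Q ^ (1 + 2 * c) * Q ^ (-c) := by
      rw [← Real.rpow_add hQ]; ring_nf
    have : 0 < Q ^ (-c) := by positivity
    rw [hq] at hfs
    refine mul_left_cancel₀ this.ne' ?_
    linear_combination hfs
  have hqi : Q ^ (-(1 + 2 * c)) * Q ^ (1 + 2 * c) = 1 := by
    rw [← Real.rpow_add hQ]; simp
  set X := Q ^ (1 + 2 * c) with hX
  set Y := Q ^ (-(1 + 2 * c)) with hY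
  have hX0 : 0 < X := by positivity
  have hY0 : 0 < Y := by positivity
  constructor
  · refine le_of_mul_le_mul_right ?_ hP0
    calc t ^ (2 * (∑ i, w i) * c - (∑ i, w i + k)) * P
        ≤ t ^ (∑ i, (w i * (1 + 2 * c) - 1)) * P := by gcongr
      _ ≤ (∏ i, C i) * P' := lo
      _ ≤ (∏ i, C i) * P' * (M * ‖F s'‖) := le_mul_of_one_le_right (by positivity) hF2
      _ = (∏ i, C i) * M * (Y * (X * P' * ‖F s'‖)) := by
          linear_combination (-(∏ i, C i) * P' * (M * ‖F s'‖)) * hqi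
      _ = Y * (∏ i, C i) * M * ‖F s‖ * P := by rw [← eq1]; ring
      _ ≤ _ := by
          gcongr
          linarith
  · refine le_of_mul_le_mul_right ?_ hP0
    rw [eq1]
    calc X * P' * ‖F s'‖
        ≤ X * ((∏ i, C i) * t ^ (2 * (∑ i, w i) * c + (∑ i, w i + k)) * P) * M := by gcongr
      _ = X * (∏ i, C i) * M * t ^ (2 * (∑ i, w i) * c + (∑ i, w i + k)) * P := by ring
      _ ≤ _ := by
          gcongr
          linarith

end Selberg

/-! ### Test functions near an integer and their Mellin transforms -/

namespace Selberg

open MeasureTheory Set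
open scoped ContDiff Topology

/-- Smooth functions on the line supported near `ν`. -/
structure IsTestFunction (ν : ℝ) (f : ℝ → ℂ) : Prop where
  smooth : ContDiff ℝ ∞ f
  tsupport_subset : tsupport f ⊆ Icc (ν - 1 / 4) (ν + 1 / 4)

namespace IsTestFunction

variable {ν : ℝ} {f : ℝ → ℂ}

lemma eq_zero (hf : IsTestFunction ν f) {x : ℝ} (hx : 1 / 2 ≤ |x - ν|) : f x = 0 := by
  by_contra h
  have := hf.tsupport_subset (subset_tsupport f h)
  have h2 : |x - ν| ≤ 1 / 4 := abs_le.2 ⟨by linarith [this.1], by linarith [this.2]⟩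
  linarith

lemma deriv (hf : IsTestFunction ν f) : IsTestFunction ν (deriv f) :=
  ⟨(contDiff_infty_iff_deriv.1 hf.smooth).2,
    (closure_minimal (support_deriv_subset (f := f)) (isClosed_tsupport f)).trans
      hf.tsupport_subset⟩

lemma ofReal_mul (hf : IsTestFunction ν f) : IsTestFunction ν fun x => (x : ℂ) * f x :=
  ⟨Complex.ofRealCLM.contDiff.mul hf.smooth, (tsupport_mul_subset_right).trans hf.tsupport_subset⟩

lemma neg (hf : IsTestFunction ν f) : IsTestFunction ν fun x => -f x :=
  ⟨hf.smooth.neg, by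
    have : tsupport (fun x => -f x) = tsupport f := by
      simp only [tsupport, Function.support_fun_neg]
    rw [this]; exact hf.tsupport_subset⟩

lemma iterate_deriv (hf : IsTestFunction ν f) (r : ℕ) : IsTestFunction ν (_root_.deriv^[r] f) := by
  induction r with
  | zero => exact hf
  | succ r ih => rw [Function.iterate_succ_apply']; exact ih.deriv

lemma mellin_eq (hf : IsTestFunction ν f) (hν : 1 ≤ ν) (s : ℂ) :
    mellin f s = ∫ x in (ν - 1 / 2)..(ν + 1 / 2), (x : ℂ) ^ (s - 1) * f x := by
  rw [mellin, intervalIntegral.integral_of_le (by linarith)]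
  simp only [smul_eq_mul]
  refine setIntegral_eq_of_subset_of_forall_sdiff_eq_zero measurableSet_Ioi
    (fun x hx => lt_trans (by linarith) hx.1) fun x hx => ?_
  rw [hf.eq_zero, mul_zero]
  by_contra h
  rw [not_le, abs_lt] at h
  exact hx.2 ⟨by linarith, by linarith⟩

/-- For `ν ≥ 1` the interval `[ν - 1/2, ν + 1/2]` lies in `[ν/2, 2ν]`, which accounts for the factor
`2 ^ |Re s - 1|`. Its exponential dependence on `Re s` later gives the threshold `2 Q²`. -/
lemma norm_mellin_le (hf : IsTestFunction ν f) (hν : 1 ≤ ν) {M : ℝ} (hM : ∀ x, ‖f x‖ ≤ M) (s : ℂ) :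
    ‖mellin f s‖ ≤ M * 2 ^ |s.re - 1| * ν ^ (s.re - 1) := by
  rw [hf.mellin_eq hν]
  have hM0 : 0 ≤ M := (norm_nonneg _).trans (hM 0)
  refine (intervalIntegral.norm_integral_le_of_norm_le_const
    (C := M * 2 ^ |s.re - 1| * ν ^ (s.re - 1)) fun x hx => ?_).trans_eq ?_
  · rw [uIoc_of_le (by linarith)] at hx
    have hx0 : 0 < x := by linarith [hx.1]
    rw [norm_mul, Complex.norm_cpow_eq_rpow_re_of_pos hx0, mul_comm, mul_assoc]
    refine mul_le_mul (hM x) ?_ (by positivity) hM0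
    simp only [Complex.sub_re, Complex.one_re]
    rcases le_total 0 (s.re - 1) with h | h
    · rw [abs_of_nonneg h, ← Real.mul_rpow (by norm_num) (by linarith)]
      exact Real.rpow_le_rpow hx0.le (by linarith [hx.2]) h
    · rw [abs_of_nonpos h, Real.rpow_neg (by norm_num), inv_mul_eq_div,
        ← Real.div_rpow (by linarith) (by norm_num)]
      exact Real.rpow_le_rpow_of_nonpos (by linarith) (by linarith [hx.1]) h
  · rw [show ν + 1 / 2 - (ν - 1 / 2) = 1 by ring]; simp

lemma mellin_deriv (hf : IsTestFunction ν f) (hν : 1 ≤ ν) (s : ℂ) :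
    mellin (_root_.deriv f) (s + 1) = -s * mellin f s := by
  rw [hf.mellin_eq hν, hf.deriv.mellin_eq hν, add_sub_cancel_right]
  have hle : ν - 1 / 2 ≤ ν + 1 / 2 := by linarith
  have hpos : ∀ x ∈ uIcc (ν - 1 / 2) (ν + 1 / 2), 0 < x := fun x hx => by
    rw [uIcc_of_le hle] at hx; linarith [hx.1]
  have h := intervalIntegral.integral_mul_deriv_eq_deriv_mul
    (u := fun x : ℝ => (x : ℂ) ^ s) (u' := fun x : ℝ => s * (x : ℂ) ^ (s - 1))
    (v := f) (v' := _root_.deriv f) (a := ν - 1 / 2) (b := ν + 1 / 2) ?_ ?_ ?_ ?_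
  · rw [h, hf.eq_zero (x := ν + 1 / 2), hf.eq_zero (x := ν - 1 / 2)]
    · simp_rw [mul_assoc]
      rw [intervalIntegral.integral_const_mul]
      ring
    · rw [le_abs]; right; linarith
    · rw [le_abs]; left; linarith
  · intro x hx
    have h2 := ((hasDerivAt_id (x : ℂ)).cpow_const (c := s)
      (Complex.ofReal_mem_slitPlane.2 (hpos x hx))).comp_ofReal
    simpa using h2
  · intro x _
    exact ((hf.smooth.differentiable (by simp)) x).hasDerivAt
  · refine ContinuousOn.intervalIntegrable fun x hx => ContinuousAt.continuousWithinAt ?_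
    exact continuousAt_const.mul
      (Complex.continuous_ofReal.continuousAt.cpow continuousAt_const
        (Complex.ofReal_mem_slitPlane.2 (hpos x hx)))
  · exact hf.deriv.smooth.continuous.intervalIntegrable _ _

/-- Integration by parts `r` times; each one produces a factor `s + i`, whose imaginary part is that
of `s`. -/
lemma pow_mul_norm_mellin_le (hf : IsTestFunction ν f) (hν : 1 ≤ ν) (r : ℕ) (s : ℂ) :
    |s.im| ^ r * ‖mellin f s‖ ≤ ‖mellin (_root_.deriv^[r] f) (s + r)‖ := by
  induction r with
  | zero => simp
  | succ r ih =>
    rw [Function.iterate_succ_apply', Nat.cast_succ, ← add_assoc,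
      (hf.iterate_deriv r).mellin_deriv hν, norm_mul, norm_neg, pow_succ', mul_assoc]
    have : |s.im| ≤ ‖s + r‖ := by simpa using Complex.abs_im_le_norm (s + r)
    gcongr

lemma differentiable_mellin (hf : IsTestFunction ν f) (hν : 1 ≤ ν) :
    Differentiable ℂ (mellin f) := fun s => by
  refine mellin_differentiableAt_of_isBigO_rpow (a := s.re + 1) (b := s.re - 1)
    (hf.smooth.continuous.locallyIntegrable.locallyIntegrableOn _) ?_ (by linarith) ?_ (by linarith)
  · refine EventuallyEq.trans_isBigO ?_ (isBigO_zero _ _)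
    filter_upwards [eventually_ge_atTop (ν + 1 / 2)] with x hx
    exact hf.eq_zero (le_abs.2 (Or.inl (by linarith)))
  · refine EventuallyEq.trans_isBigO ?_ (isBigO_zero _ _)
    filter_upwards [mem_nhdsWithin_of_mem_nhds (Iio_mem_nhds (show (0 : ℝ) < 1 / 2 by norm_num))]
      with x hx
    exact hf.eq_zero (le_abs.2 (Or.inr (by have : x < 1 / 2 := hx; linarith)))

lemma mellinConvergent (hf : IsTestFunction ν f) (hν : 1 ≤ ν) (s : ℂ) : MellinConvergent f s := by
  refine mellinConvergent_of_isBigO_rpow (a := s.re + 1) (b := s.re - 1)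
    (hf.smooth.continuous.locallyIntegrable.locallyIntegrableOn _) ?_ (by linarith) ?_ (by linarith)
  · refine EventuallyEq.trans_isBigO ?_ (isBigO_zero _ _)
    filter_upwards [eventually_ge_atTop (ν + 1 / 2)] with x hx
    exact hf.eq_zero (le_abs.2 (Or.inl (by linarith)))
  · refine EventuallyEq.trans_isBigO ?_ (isBigO_zero _ _)
    filter_upwards [mem_nhdsWithin_of_mem_nhds (Iio_mem_nhds (show (0 : ℝ) < 1 / 2 by norm_num))]
      with x hx
    exact hf.eq_zero (le_abs.2 (Or.inr (by have : x < 1 / 2 := hx; linarith)))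

lemma exists_norm_le (hf : IsTestFunction ν f) : ∃ M, ∀ x, ‖f x‖ ≤ M := by
  have hc : HasCompactSupport f :=
    isCompact_Icc.of_isClosed_subset (isClosed_tsupport f) hf.tsupport_subset
  exact hc.exists_bound_of_continuous hf.smooth.continuous

end IsTestFunction

lemma one_add_abs_pow_le (t : ℝ) (r : ℕ) : (1 + |t|) ^ r ≤ 2 ^ r * (1 + |t| ^ r) := by
  refine (add_pow_le zero_le_one (abs_nonneg t) r).trans ?_
  rw [one_pow]
  gcongr
  · norm_num
  · omega

/-- The Mellin transform of a test function decays rapidly on vertical lines. -/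
lemma IsTestFunction.decay {ν : ℝ} {f : ℝ → ℂ} (hf : IsTestFunction ν f) (hν : 1 ≤ ν) (r : ℕ)
    {M : ℝ} (hM0 : ∀ x, ‖f x‖ ≤ M) (hM : ∀ x, ‖_root_.deriv^[r] f x‖ ≤ M) (s : ℂ) :
    (1 + |s.im|) ^ r * ‖mellin f s‖ ≤ 4 ^ (r + 1) * M * 2 ^ |s.re| * ν ^ (s.re + r - 1) := by
  have hMn : 0 ≤ M := (norm_nonneg _).trans (hM 0)
  have h1 := hf.norm_mellin_le hν hM0 s
  have h2 := (hf.pow_mul_norm_mellin_le hν r s).trans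
    ((hf.iterate_deriv r).norm_mellin_le hν hM (s + r))
  have hre : (s + r).re = s.re + r := by simp
  rw [hre] at h2
  set A := M * 2 ^ (|s.re| + (r + 1)) * ν ^ (s.re + r - 1) with hA
  have hν0 : 0 < ν := by linarith
  have hr : (0 : ℝ) ≤ r := by positivity
  have k1 : ‖mellin f s‖ ≤ A := by
    refine h1.trans ?_
    have : |s.re - 1| ≤ |s.re| + (r + 1) := by
      have := abs_sub s.re 1
      rw [abs_one] at this
      linarith
    simp only [hA]
    gcongr
    · norm_num
    · linarith
  have k2 : |s.im| ^ r * ‖mellin f s‖ ≤ A := by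
    refine h2.trans ?_
    have : |s.re + r - 1| ≤ |s.re| + (r + 1) := by
      have := abs_sub (s.re + r) 1
      have h3 := abs_add_le s.re r
      rw [abs_one] at this
      rw [abs_of_nonneg hr] at h3
      linarith
    simp only [hA]
    gcongr
    norm_num
  calc (1 + |s.im|) ^ r * ‖mellin f s‖ ≤ 2 ^ r * (1 + |s.im| ^ r) * ‖mellin f s‖ := by
        gcongr
        exact one_add_abs_pow_le _ _
    _ = 2 ^ r * (‖mellin f s‖ + |s.im| ^ r * ‖mellin f s‖) := by ring
    _ ≤ 2 ^ r * (A + A) := by gcongr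
    _ = _ := by
        simp only [hA]
        rw [Real.rpow_add (by norm_num), ← Nat.cast_succ, Real.rpow_natCast]
        rw [show (4 : ℝ) = 2 * 2 by norm_num, mul_pow, pow_succ]
        ring

lemma integrable_of_norm_le_div {g : ℝ → ℂ} (hg : Continuous g) {C : ℝ}
    (h : ∀ t, ‖g t‖ ≤ C * (1 + t ^ 2)⁻¹) : Integrable g :=
  (integrable_inv_one_add_sq.const_mul C).mono' hg.aestronglyMeasurable (Eventually.of_forall h)

lemma inv_one_add_abs_sq_le (t : ℝ) : ((1 + |t|) ^ 2)⁻¹ ≤ (1 + t ^ 2)⁻¹ := by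
  have := abs_nonneg t
  have h2 := sq_abs t
  gcongr
  nlinarith

lemma continuous_vertical_line (σ : ℝ) : Continuous fun t : ℝ => (σ : ℂ) + t * Complex.I := by
  fun_prop

lemma IsTestFunction.verticalIntegrable {ν : ℝ} {f : ℝ → ℂ} (hf : IsTestFunction ν f)
    (hν : 1 ≤ ν) (σ : ℝ) : Integrable fun t : ℝ => mellin f (σ + t * Complex.I) := by
  obtain ⟨M, hM⟩ := hf.exists_norm_le
  obtain ⟨M', hM'⟩ := (hf.iterate_deriv 2).exists_norm_le
  refine integrable_of_norm_le_div ((hf.differentiable_mellin hν).continuous.comp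
    (continuous_vertical_line σ))
    (C := 4 ^ (2 + 1) * max M M' * 2 ^ |σ| * ν ^ (σ + (2 : ℕ) - 1)) fun t => ?_
  have := hf.decay hν 2 (fun x => (hM x).trans (le_max_left M M'))
    (fun x => (hM' x).trans (le_max_right M M')) (σ + t * Complex.I)
  have hre : ((σ : ℂ) + t * Complex.I).re = σ := by simp
  have him : ((σ : ℂ) + t * Complex.I).im = t := by simp
  rw [hre, him] at this
  have h0 : 0 ≤ 4 ^ (2 + 1) * max M M' * 2 ^ |σ| * ν ^ (σ + (2 : ℕ) - 1) :=
    le_trans (by positivity) this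
  calc _ ≤ 4 ^ (2 + 1) * max M M' * 2 ^ |σ| * ν ^ (σ + (2 : ℕ) - 1) * ((1 + |t|) ^ 2)⁻¹ := by
        rw [← div_eq_mul_inv, le_div_iff₀ (by positivity), mul_comm]
        exact this
    _ ≤ _ := by
        exact mul_le_mul_of_nonneg_left (inv_one_add_abs_sq_le t) h0

/-- Multiplication of the Mellin transform by `s - 1`, on the level of test functions. -/
noncomputable def mulSubOne (f : ℝ → ℂ) : ℝ → ℂ := fun x => -deriv (fun y : ℝ => (y : ℂ) * f y) x

lemma IsTestFunction.mulSubOne {ν : ℝ} {f : ℝ → ℂ} (hf : IsTestFunction ν f) :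
    IsTestFunction ν (mulSubOne f) :=
  hf.ofReal_mul.deriv.neg

/-- This lets the polar factor `(s - 1) ^ m` be moved from the Dirichlet series to the test
function. -/
lemma IsTestFunction.mellin_mulSubOne {ν : ℝ} {f : ℝ → ℂ} (hf : IsTestFunction ν f) (hν : 1 ≤ ν)
    (s : ℂ) : mellin (Selberg.mulSubOne f) s = (s - 1) * mellin f s := by
  have h := hf.ofReal_mul.mellin_deriv hν (s - 1)
  rw [sub_add_cancel] at h
  have h2 : mellin (fun x : ℝ => (x : ℂ) * f x) (s - 1) = mellin f s := by
    have := mellin_cpow_smul f (s - 1) 1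
    simpa using this
  have h3 : mellin (Selberg.mulSubOne f) s
      = -mellin (_root_.deriv fun y : ℝ => (y : ℂ) * f y) s := by
    simp only [mellin, Selberg.mulSubOne, smul_neg, integral_neg]
  rw [h3, h, h2]
  ring

/-- The operator `f ↦ -(x f)'` is local, so a plateau of `f` at `ν` survives with its sign reversed.
This is why the bump has to be constant near `ν`, and not merely equal to `1` there. -/
lemma mulSubOne_eventuallyEq {ν : ℝ} {f : ℝ → ℂ} {c : ℂ} (h : f =ᶠ[𝓝 ν] fun _ => c) :
    mulSubOne f =ᶠ[𝓝 ν] fun _ => -c := by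
  filter_upwards [h.eventuallyEq_nhds] with x hx
  have : (fun y : ℝ => (y : ℂ) * f y) =ᶠ[𝓝 x] fun y : ℝ => (y : ℂ) * c := by
    filter_upwards [hx] with y hy
    rw [hy]
  rw [mulSubOne, this.deriv_eq]
  have h2 : HasDerivAt (fun y : ℝ => (y : ℂ) * c) (1 * c) x :=
    (Complex.ofRealCLM.hasDerivAt (x := x)).mul_const c
  rw [h2.deriv, one_mul]

lemma mulSubOne_iterate_eventuallyEq {ν : ℝ} {f : ℝ → ℂ} (h : f =ᶠ[𝓝 ν] fun _ => 1) (m : ℕ) :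
    mulSubOne^[m] f =ᶠ[𝓝 ν] fun _ => (-1) ^ m := by
  induction m with
  | zero => simpa using h
  | succ m ih =>
    rw [Function.iterate_succ_apply', pow_succ', neg_one_mul]
    exact mulSubOne_eventuallyEq ih

lemma IsTestFunction.mulSubOne_iterate {ν : ℝ} {f : ℝ → ℂ} (hf : IsTestFunction ν f)
    (hν : 1 ≤ ν) (m : ℕ) : IsTestFunction ν (Selberg.mulSubOne^[m] f) ∧
      ∀ s, mellin (Selberg.mulSubOne^[m] f) s = (s - 1) ^ m * mellin f s := by
  induction m with
  | zero => simpa using hf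
  | succ m ih =>
    rw [Function.iterate_succ_apply']
    refine ⟨ih.1.mulSubOne, fun s => ?_⟩
    rw [ih.1.mellin_mulSubOne hν, ih.2, pow_succ']
    ring

/-- Mellin inversion picks out a value of a test function. -/
lemma IsTestFunction.integral_cpow_mul_mellin {ν : ℝ} {f : ℝ → ℂ} (hf : IsTestFunction ν f)
    (hν : 1 ≤ ν) (σ : ℝ) {x : ℝ} (hx : 0 < x) :
    ∫ t : ℝ, (x : ℂ) ^ (-((σ : ℂ) + t * Complex.I)) * mellin f (σ + t * Complex.I)
      = 2 * Real.pi * f x := by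
  have h := mellinInv_mellin_eq σ f hx (hf.mellinConvergent hν σ) (hf.verticalIntegrable hν σ)
    hf.smooth.continuous.continuousAt
  rw [← h, mellinInv]
  simp only [smul_eq_mul, Complex.real_smul]
  push_cast
  have : (Real.pi : ℂ) ≠ 0 := by exact_mod_cast Real.pi_ne_zero
  rw [← mul_assoc, mul_one_div_cancel (by simp), one_mul]

/-- The mean value of a Dirichlet series against the Mellin transform of a test function near the
integer `n` is its `n`-th coefficient. -/
lemma IsTestFunction.integral_LSeries_mul_mellin {n : ℕ} {f : ℝ → ℂ} (hf : IsTestFunction n f)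
    (hn : 1 ≤ n) {a : ℕ → ℂ} {σ : ℝ} (ha : LSeriesSummable a σ) :
    ∫ t : ℝ, LSeries a (σ + t * Complex.I) * mellin f (σ + t * Complex.I)
      = 2 * Real.pi * (a n * f n) := by
  have hν : (1 : ℝ) ≤ n := by exact_mod_cast hn
  have hint := hf.verticalIntegrable hν σ
  have hnorm : ∀ (l : ℕ) (t : ℝ), ‖LSeries.term a (σ + t * Complex.I) l‖
      = ‖LSeries.term a σ l‖ := fun l t => by simp [LSeries.norm_term_eq]
  have hcont : ∀ l : ℕ, Continuous fun t : ℝ => LSeries.term a (σ + t * Complex.I) l := fun l => by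
    rcases eq_or_ne l 0 with rfl | hl
    · simpa using continuous_const
    · simp only [LSeries.term_of_ne_zero hl]
      have hl' : (l : ℂ) ≠ 0 := by exact_mod_cast hl
      refine continuous_const.div ((continuous_vertical_line σ).const_cpow (Or.inl hl'))
        fun t => by simp [Complex.cpow_eq_zero_iff, hl']
  have hI : ∀ l : ℕ, Integrable fun t : ℝ =>
      LSeries.term a (σ + t * Complex.I) l * mellin f (σ + t * Complex.I) := fun l =>
    hint.bdd_mul (c := ‖LSeries.term a σ l‖) (hcont l).aestronglyMeasurable
      (Eventually.of_forall fun t => (hnorm l t).le)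
  have hS := hasSum_integral_of_summable_integral_norm hI (by
    simp_rw [norm_mul, hnorm, integral_const_mul]
    exact ha.norm.mul_right _)
  -- The support has radius less than `1/2`, so `n` is the only integer at which `f` can be nonzero.
  have hval : ∀ l : ℕ, ∫ t : ℝ, LSeries.term a (σ + t * Complex.I) l *
      mellin f (σ + t * Complex.I) = if l = n then 2 * Real.pi * (a n * f n) else 0 := fun l => by
    rcases eq_or_ne l 0 with rfl | hl
    · rw [if_neg (by omega)]; simp
    have hl0 : (0 : ℝ) < l := by exact_mod_cast Nat.pos_of_ne_zero hl
    have := hf.integral_cpow_mul_mellin hν σ hl0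
    simp only [LSeries.term_of_ne_zero hl, div_eq_mul_inv, ← Complex.cpow_neg, mul_assoc]
    rw [integral_const_mul]
    simp only [Complex.ofReal_natCast] at this
    rw [this]
    split_ifs with h
    · subst h; ring
    · rw [hf.eq_zero]
      · ring
      · have h1 : (1 : ℤ) ≤ |(l : ℤ) - n| := Int.one_le_abs (sub_ne_zero.2 (by exact_mod_cast h))
        have h1 : (1 : ℝ) ≤ |(l : ℝ) - n| := by exact_mod_cast h1
        linarith
  simp_rw [hval] at hS
  have h2 := hS.unique (hasSum_ite_eq n _)
  rw [← h2]
  refine integral_congr_ae (Eventually.of_forall fun t => ?_)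
  simp only [LSeries]
  rw [tsum_mul_right]

/-- A fixed bump function around the origin, translated to `ν`. -/
noncomputable def translatedBump (ν : ℝ) : ℝ → ℂ := fun x =>
  (((⟨1 / 8, 1 / 4, by norm_num, by norm_num⟩ : ContDiffBump (0 : ℝ)) (x - ν) : ℝ) : ℂ)

lemma isTestFunction_translatedBump (ν : ℝ) : IsTestFunction ν (translatedBump ν) := by
  refine ⟨Complex.ofRealCLM.contDiff.comp
    ((ContDiffBump.contDiff _).comp (contDiff_id.sub contDiff_const)), ?_⟩
  refine closure_minimal (fun x hx => ?_) isClosed_Icc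
  have h : x - ν ∈ Function.support
      (⟨1 / 8, 1 / 4, by norm_num, by norm_num⟩ : ContDiffBump (0 : ℝ)) := by
    intro h
    exact hx (by rw [translatedBump, h, Complex.ofReal_zero])
  rw [ContDiffBump.support_eq, mem_ball_zero_iff, Real.norm_eq_abs, abs_lt] at h
  simp only at h
  exact ⟨by linarith [h.1], by linarith [h.2]⟩

lemma translatedBump_eventuallyEq (ν : ℝ) : translatedBump ν =ᶠ[𝓝 ν] fun _ => 1 := by
  have h := (⟨1 / 8, 1 / 4, by norm_num, by norm_num⟩ : ContDiffBump (0 : ℝ)).eventuallyEq_one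
  have ht : Tendsto (fun x : ℝ => x - ν) (𝓝 ν) (𝓝 0) := by
    have : Tendsto (fun x : ℝ => x - ν) (𝓝 ν) (𝓝 (ν - ν)) := tendsto_id.sub_const ν
    simpa using this
  filter_upwards [ht.eventually h] with x hx
  simp only [translatedBump]
  rw [hx]
  simp

lemma iterate_deriv_translatedBump (ν : ℝ) (r : ℕ) :
    deriv^[r] (translatedBump ν) = fun x => deriv^[r] (translatedBump 0) (x - ν) := by
  induction r with
  | zero => funext x; simp [translatedBump]
  | succ r ih =>
    rw [Function.iterate_succ_apply', Function.iterate_succ_apply', ih]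
    funext x
    exact deriv_comp_sub_const (f := deriv^[r] (translatedBump 0)) ν x

lemma exists_mellin_translatedBump_decay (r : ℕ) :
    ∃ C > 0, ∀ ν : ℝ, 1 ≤ ν → ∀ s : ℂ,
      (1 + |s.im|) ^ r * ‖mellin (translatedBump ν) s‖ ≤ C * 2 ^ |s.re| * ν ^ (s.re + r - 1) := by
  obtain ⟨M, hM⟩ := (isTestFunction_translatedBump 0).exists_norm_le
  obtain ⟨M', hM'⟩ := ((isTestFunction_translatedBump 0).iterate_deriv r).exists_norm_le
  have hM0 : 0 ≤ M := (norm_nonneg _).trans (hM 0)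
  have hM'0 : 0 ≤ M' := (norm_nonneg _).trans (hM' 0)
  -- The sup norms of the bump and of its `r`-th derivative are translation invariant, so one
  -- constant serves all `ν`.
  refine ⟨4 ^ (r + 1) * (M + M' + 1), by positivity, fun ν hν s => ?_⟩
  refine (isTestFunction_translatedBump ν).decay hν r (fun x => ?_) (fun x => ?_) s
  · have := iterate_deriv_translatedBump ν 0
    simp only [Function.iterate_zero, id] at this
    rw [this]
    linarith [hM (x - ν)]
  · rw [iterate_deriv_translatedBump]
    linarith [hM' (x - ν)]

end Selberg

/-! ### Contour shift and the resulting coefficient bound -/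

namespace Selberg

open MeasureTheory Set
open scoped Topology

/-- Shifting a vertical line of integration. -/
lemma integral_vertical_line_eq {H : ℂ → ℂ} (hH : Differentiable ℂ H) {a b C : ℝ} (hab : a ≤ b)
    (hC : ∀ s : ℂ, a ≤ s.re → s.re ≤ b → ‖H s‖ ≤ C * (1 + s.im ^ 2)⁻¹) :
    ∫ t : ℝ, H (a + t * Complex.I) = ∫ t : ℝ, H (b + t * Complex.I) := by
  have hint : ∀ σ : ℝ, a ≤ σ → σ ≤ b → Integrable fun t : ℝ => H (σ + t * Complex.I) :=
    fun σ h1 h2 => integrable_of_norm_le_div (hH.continuous.comp (continuous_vertical_line σ))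
      fun t => by simpa using hC (σ + t * Complex.I) (by simpa using h1) (by simpa using h2)
  have hlim : ∀ σ : ℝ, a ≤ σ → σ ≤ b → Tendsto (fun T : ℝ =>
      ∫ t in (-T)..T, H (σ + t * Complex.I)) atTop (𝓝 (∫ t : ℝ, H (σ + t * Complex.I))) :=
    fun σ h1 h2 => intervalIntegral_tendsto_integral (hint σ h1 h2) tendsto_neg_atTop_atBot
      tendsto_id
  have hside : ∀ T : ℝ, ‖∫ x in a..b, H (x + T * Complex.I)‖ ≤ C * (1 + T ^ 2)⁻¹ * (b - a) :=
    fun T => by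
      refine (intervalIntegral.norm_integral_le_of_norm_le_const (C := C * (1 + T ^ 2)⁻¹)
        fun x hx => ?_).trans_eq (by rw [abs_of_nonneg (sub_nonneg.2 hab)])
      rw [uIoc_of_le hab] at hx
      simpa using hC (x + T * Complex.I) (by simpa using hx.1.le) (by simpa using hx.2)
  have hdecay : Tendsto (fun T : ℝ => C * (1 + T ^ 2)⁻¹ * (b - a)) atTop (𝓝 0) := by
    have : Tendsto (fun T : ℝ => (1 + T ^ 2)⁻¹) atTop (𝓝 0) :=
      tendsto_inv_atTop_zero.comp
        (tendsto_atTop_add_const_left _ _ (tendsto_pow_atTop two_ne_zero))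
    simpa using (this.const_mul C).mul_const (b - a)
  have hrect : ∀ T : ℝ, ‖(∫ t in (-T)..T, H (b + t * Complex.I)) -
      ∫ t in (-T)..T, H (a + t * Complex.I)‖ ≤ 2 * (C * (1 + T ^ 2)⁻¹ * (b - a)) := fun T => by
    have h := Complex.integral_boundary_rect_eq_zero_of_differentiableOn H
      (a + (-T : ℝ) * Complex.I) (b + T * Complex.I) hH.differentiableOn
    simp only [Complex.add_re, Complex.ofReal_re, Complex.re_ofReal_mul, Complex.I_re, mul_zero,
      add_zero, Complex.add_im, Complex.ofReal_im, Complex.im_ofReal_mul, Complex.I_im, mul_one,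
      zero_add, smul_eq_mul] at h
    have e : Complex.I * ((∫ t in (-T)..T, H (b + t * Complex.I)) -
        ∫ t in (-T)..T, H (a + t * Complex.I)) = (∫ x in a..b, H (x + T * Complex.I)) -
        ∫ x in a..b, H (x + (-T : ℝ) * Complex.I) := by linear_combination h
    have e2 := congrArg norm e
    rw [norm_mul, Complex.norm_I, one_mul] at e2
    rw [e2]
    refine (norm_sub_le _ _).trans ?_
    have h1 := hside T
    have h2 := hside (-T)
    rw [neg_sq] at h2
    linarith
  have h0 : Tendsto (fun T : ℝ => (∫ t in (-T)..T, H (b + t * Complex.I)) -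
      ∫ t in (-T)..T, H (a + t * Complex.I)) atTop (𝓝 0) :=
    squeeze_zero_norm hrect (by simpa using hdecay.const_mul 2)
  have h1 := (hlim b hab le_rfl).sub (hlim a le_rfl hab)
  exact (sub_eq_zero.1 (tendsto_nhds_unique h1 h0)).symm

/-- Inside a strip this turns finite order into the growth `exp (B exp (c |t|))`, with `c` as small
as desired, that Phragmén–Lindelöf allows. -/
lemma rpow_le_exp_of_le {ρ c K : ℝ} (hc : 0 < c) :
    ∃ B > 0, ∀ x t : ℝ, 1 ≤ x → x ≤ K + t → x ^ ρ ≤ B * Real.exp (c * t) := by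
  obtain ⟨N, hN⟩ := exists_nat_ge ρ
  refine ⟨N.factorial / c ^ N * Real.exp (c * K), by positivity, fun x t hx hxt => ?_⟩
  have h1 : x ^ ρ ≤ x ^ N := by
    rw [← Real.rpow_natCast]
    exact Real.rpow_le_rpow_of_exponent_le hx hN
  have h2 := Real.pow_div_factorial_le_exp (x := c * x) (by positivity) N
  rw [div_le_iff₀ (by positivity), mul_pow] at h2
  have h3 : Real.exp (c * x) ≤ Real.exp (c * K) * Real.exp (c * t) := by
    rw [← Real.exp_add, ← mul_add]
    gcongr
  calc x ^ ρ ≤ x ^ N := h1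
    _ ≤ Real.exp (c * x) * N.factorial / c ^ N := by
        rw [le_div_iff₀ (by positivity)]; linarith
    _ ≤ Real.exp (c * K) * Real.exp (c * t) * N.factorial / c ^ N := by gcongr
    _ = _ := by ring

/-- An entire function of finite order that grows polynomially on both sides of a vertical strip
grows polynomially in the strip. -/
lemma exists_norm_le_in_strip {E : ℂ → ℂ} (hE : Differentiable ℂ E) (hfo : HasFiniteOrder E)
    {a b C : ℝ} {k : ℕ} (hab : a < b)
    (ha : ∀ s : ℂ, s.re = a → ‖E s‖ ≤ C * (1 + |s.im|) ^ k)
    (hb : ∀ s : ℂ, s.re = b → ‖E s‖ ≤ C * (1 + |s.im|) ^ k) :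
    ∃ C' > 0, ∀ s : ℂ, a ≤ s.re → s.re ≤ b → ‖E s‖ ≤ C' * (1 + |s.im|) ^ k := by
  have hC0 : 0 ≤ C := by
    have := (norm_nonneg _).trans (ha a (by simp))
    simpa using this
  -- In the strip `Re (s - a + 1) ≥ 1`, so the divisor has no zeros there and is comparable to `1 +
  -- |Im s|`; the quotient is bounded on both edges.
  set g : ℂ → ℂ := fun s => E s / (s - a + 1) ^ k with hg
  have hre : ∀ s : ℂ, a ≤ s.re → 1 ≤ ‖s - a + 1‖ ∧ (1 + |s.im|) ≤ 2 * ‖s - a + 1‖ := fun s hs => by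
    have h1 := Complex.re_le_norm (s - a + 1)
    have h2 := Complex.abs_im_le_norm (s - a + 1)
    simp only [Complex.add_re, Complex.sub_re, Complex.ofReal_re, Complex.one_re, Complex.add_im,
      Complex.sub_im, Complex.ofReal_im, Complex.one_im, sub_zero, add_zero] at h1 h2
    constructor <;> linarith
  have hne : ∀ s : ℂ, a ≤ s.re → s - a + 1 ≠ 0 := fun s hs h0 => by
    have := (hre s hs).1
    rw [h0, norm_zero] at this
    linarith
  have hside : ∀ s : ℂ, a ≤ s.re → ‖E s‖ ≤ C * (1 + |s.im|) ^ k → ‖g s‖ ≤ C * 2 ^ k := by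
    intro s hs h
    have h1 := hre s hs
    rw [hg]
    simp only
    rw [norm_div, norm_pow, div_le_iff₀ (pow_pos (by linarith) k), mul_assoc, ← mul_pow]
    refine h.trans ?_
    gcongr
    exact h1.2
  have hclosure : closure (Complex.re ⁻¹' Ioo a b) ⊆ Complex.re ⁻¹' Icc a b :=
    closure_minimal (preimage_mono Ioo_subset_Icc_self)
      (isClosed_Icc.preimage Complex.continuous_re)
  have hpl : ∀ s : ℂ, a ≤ s.re → s.re ≤ b → ‖g s‖ ≤ C * 2 ^ k := by
    intro s h1 h2
    refine PhragmenLindelof.vertical_strip (a := a) (b := b) (f := g) ?_ ?_ ?_ ?_ h1 h2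
    · refine DifferentiableOn.diffContOnCl fun z hz => ?_
      have hz' := hne z (hclosure hz).1
      refine DifferentiableAt.differentiableWithinAt ?_
      exact (hE z).div (by fun_prop) (pow_ne_zero _ hz')
    · obtain ⟨ρ, hρ⟩ := hfo
      have hp : 0 < Real.pi / (b - a) := div_pos Real.pi_pos (sub_pos.2 hab)
      obtain ⟨B, hB, hBx⟩ := rpow_le_exp_of_le (ρ := ρ) (K := |a| + |b|) (half_pos hp)
      refine ⟨Real.pi / (b - a) / 2, half_lt_self hp, B, ?_⟩
      obtain ⟨D, hD⟩ := hρ.bound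
      have hcob : comap (_root_.abs ∘ Complex.im) atTop ≤ Bornology.cobounded ℂ := by
        rw [← comap_norm_atTop, ← tendsto_iff_comap]
        exact tendsto_atTop_mono (fun s => Complex.abs_im_le_norm s) tendsto_comap
      have hlarge : ∀ᶠ s : ℂ in comap (_root_.abs ∘ Complex.im) atTop, 1 ≤ |s.im| :=
        tendsto_comap.eventually (eventually_ge_atTop 1)
      refine IsBigO.of_bound D ?_
      filter_upwards [mem_inf_of_left (hcob hD), mem_inf_of_left hlarge,
        mem_inf_of_right (mem_principal_self _)] with s h3 h4 h5
      have h6 := (hre s h5.1.le).1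
      have h7 : ‖s‖ ≤ |a| + |b| + |s.im| := by
        refine (Complex.norm_le_abs_re_add_abs_im s).trans ?_
        gcongr
        rw [abs_le]
        have := neg_abs_le a
        have := le_abs_self b
        have := abs_nonneg a
        have := abs_nonneg b
        exact ⟨by linarith [h5.1], by linarith [h5.2]⟩
      have h8 := hBx ‖s‖ |s.im| (h4.trans (Complex.abs_im_le_norm s)) h7
      have hD0 : 0 ≤ D := by
        rw [Real.norm_of_nonneg (Real.exp_pos _).le] at h3
        exact nonneg_of_mul_nonneg_left ((norm_nonneg _).trans h3) (Real.exp_pos _)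
      calc ‖g s‖ ≤ ‖E s‖ := by
            rw [hg]
            simp only
            rw [norm_div, norm_pow]
            exact div_le_self (norm_nonneg _) (one_le_pow₀ h6)
        _ ≤ D * ‖Real.exp (‖s‖ ^ ρ)‖ := h3
        _ ≤ _ := by
            rw [Real.norm_of_nonneg (Real.exp_pos _).le, Real.norm_of_nonneg (Real.exp_pos _).le]
            gcongr
    · exact fun z hz => hside z hz.ge (ha z hz)
    · exact fun z hz => hside z (by rw [hz]; exact hab.le) (hb z hz)
  refine ⟨C * 2 ^ k * (b - a + 2) ^ k + 1, ?_, fun s h1 h2 => ?_⟩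
  · have : 0 < b - a := sub_pos.2 hab
    positivity
  · have h3 := hpl s h1 h2
    have hn := (hre s h1).1
    rw [hg] at h3
    simp only at h3
    rw [norm_div, norm_pow, div_le_iff₀ (pow_pos (by linarith) k)] at h3
    have h4 : ‖s - a + 1‖ ≤ (b - a + 2) * (1 + |s.im|) := by
      refine (Complex.norm_le_abs_re_add_abs_im _).trans ?_
      simp only [Complex.add_re, Complex.sub_re, Complex.ofReal_re, Complex.one_re, Complex.add_im,
        Complex.sub_im, Complex.ofReal_im, Complex.one_im, sub_zero, add_zero]
      rw [abs_of_nonneg (by linarith)]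
      nlinarith [abs_nonneg s.im]
    calc ‖E s‖ ≤ C * 2 ^ k * ‖s - a + 1‖ ^ k := h3
      _ ≤ C * 2 ^ k * ((b - a + 2) * (1 + |s.im|)) ^ k := by gcongr
      _ = C * 2 ^ k * (b - a + 2) ^ k * (1 + |s.im|) ^ k := by rw [mul_pow]; ring
      _ ≤ _ := by
          gcongr
          linarith

/-- If the continuation of `(s - 1) ^ m * ∑ a n n⁻ˢ` grows polynomially on `Re s = -c`, then the
coefficients are small. -/
lemma exists_norm_coeff_le (k : ℕ) : ∃ K > 0, ∀ (a : ℕ → ℂ) (E : ℂ → ℂ) (m : ℕ) (c M : ℝ),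
    Differentiable ℂ E → HasFiniteOrder E → LSeriesSummable a (2 : ℝ) →
    (∀ s : ℂ, s.re = 2 → E s = (s - 1) ^ m * LSeries a s) → 0 < c →
    (∀ s : ℂ, s.re = -c → ‖E s‖ ≤ M * (1 + |s.im|) ^ k) →
    ∀ n : ℕ, 1 ≤ n → ‖a n‖ ≤ K * M * 2 ^ c * (n : ℝ) ^ (k + 1 - c) := by
  -- `K` is fixed by `k` alone, before `c`, `m` and the series are given; later arguments let `c →
  -- ∞` with `K` constant.
  obtain ⟨K, hK, hdec⟩ := exists_mellin_translatedBump_decay (k + 2)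
  refine ⟨K, hK, fun a E m c M hE hfo ha hEa hc hM n hn => ?_⟩
  have hν : (1 : ℝ) ≤ n := by exact_mod_cast hn
  set ψ := translatedBump n
  have htest := isTestFunction_translatedBump (n : ℝ)
  obtain ⟨hφ, hφm⟩ := htest.mulSubOne_iterate hν m
  have hM0 : 0 ≤ M := by
    have := (norm_nonneg _).trans (hM ((-c : ℝ) : ℂ) (by simp))
    simpa using this
  have hright : ∫ t : ℝ, E ((2 : ℝ) + t * Complex.I) * mellin ψ ((2 : ℝ) + t * Complex.I)
      = 2 * Real.pi * (a n * (-1) ^ m) := by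
    have hval : mulSubOne^[m] (translatedBump n) n = (-1) ^ m :=
      (mulSubOne_iterate_eventuallyEq (translatedBump_eventuallyEq (n : ℝ)) m).self_of_nhds
    rw [← hval, ← hφ.integral_LSeries_mul_mellin hn ha]
    refine integral_congr_ae (Eventually.of_forall fun t => ?_)
    simp only
    rw [hφm, hEa _ (by simp)]
    ring
  obtain ⟨C', hC', hstrip⟩ := exists_norm_le_in_strip (k := max k m)
    (C := M + ∑' l, ‖LSeries.term a (2 : ℝ) l‖) hE hfo (show -c < 2 by linarith)
    (fun s hs => by
      have h0 : 0 ≤ ∑' l, ‖LSeries.term a (2 : ℝ) l‖ := tsum_nonneg fun _ => norm_nonneg _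
      refine (hM s hs).trans ?_
      gcongr
      · linarith
      · linarith [abs_nonneg s.im]
      · exact le_max_left _ _)
    (fun s hs => by
      have h1 := norm_LSeries_le_tsum ha hs
      have h2 : ‖s - 1‖ ≤ 1 + |s.im| := by
        refine (Complex.norm_le_abs_re_add_abs_im _).trans ?_
        simp [hs]; norm_num
      rw [hEa s hs, norm_mul, norm_pow, mul_comm]
      refine mul_le_mul (h1.trans (by linarith)) ?_ (by positivity) (by positivity)
      calc ‖s - 1‖ ^ m ≤ (1 + |s.im|) ^ m := by gcongr
        _ ≤ _ := by
          gcongr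
          · linarith [abs_nonneg s.im]
          · exact le_max_right _ _)
  -- A second decay rate, strong enough for the whole strip. It only justifies the shift, so its
  -- constants do not enter the final bound.
  obtain ⟨K', hK', hdec'⟩ := exists_mellin_translatedBump_decay (max k m + 2)
  have hshift : ∫ t : ℝ, E ((-c : ℝ) + t * Complex.I) * mellin ψ ((-c : ℝ) + t * Complex.I)
      = ∫ t : ℝ, E ((2 : ℝ) + t * Complex.I) * mellin ψ ((2 : ℝ) + t * Complex.I) := by
    refine integral_vertical_line_eq (H := fun s => E s * mellin ψ s)
      (C := C' * (K' * 2 ^ (c + 2) * (n : ℝ) ^ (2 + (max k m + 2 : ℕ) - 1 : ℝ)))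
      (hE.mul (htest.differentiable_mellin hν)) (by linarith) fun s h1 h2 => ?_
    have h3 := hstrip s h1 h2
    have h4 := hdec' n hν s
    have h5 : |s.re| ≤ c + 2 := abs_le.2 ⟨by linarith, by linarith⟩
    have h6 : K' * 2 ^ |s.re| * (n : ℝ) ^ (s.re + (max k m + 2 : ℕ) - 1)
        ≤ K' * 2 ^ (c + 2) * (n : ℝ) ^ (2 + (max k m + 2 : ℕ) - 1 : ℝ) := by
      gcongr
      norm_num
    set A := K' * 2 ^ (c + 2) * (n : ℝ) ^ (2 + (max k m + 2 : ℕ) - 1 : ℝ)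
    have hA : 0 ≤ A := by positivity
    have h7 := h4.trans h6
    have ht := abs_nonneg s.im
    rw [norm_mul]
    calc ‖E s‖ * ‖mellin ψ s‖ ≤ C' * (1 + |s.im|) ^ max k m * ‖mellin ψ s‖ := by gcongr
      _ = C' * ((1 + |s.im|) ^ (max k m + 2) * ‖mellin ψ s‖) * ((1 + |s.im|) ^ 2)⁻¹ := by
          rw [pow_add]; field_simp
      _ ≤ C' * A * ((1 + |s.im|) ^ 2)⁻¹ := by gcongr
      _ ≤ _ := mul_le_mul_of_nonneg_left (inv_one_add_abs_sq_le _) (by positivity)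
  rw [hright] at hshift
  have hpt : ∀ t : ℝ, ‖E ((-c : ℝ) + t * Complex.I) * mellin ψ ((-c : ℝ) + t * Complex.I)‖
      ≤ M * (K * 2 ^ c * (n : ℝ) ^ (k + 1 - c)) * (1 + t ^ 2)⁻¹ := fun t => by
    set s : ℂ := (-c : ℝ) + t * Complex.I with hs
    have hsre : s.re = -c := by simp [hs]
    have hsim : s.im = t := by simp [hs]
    have h3 := hM s hsre
    have h4 := hdec n hν s
    rw [hsre, hsim, abs_neg, abs_of_pos hc] at h4
    rw [hsim] at h3
    have ht := abs_nonneg t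
    have e : -c + ((k + 2 : ℕ) : ℝ) - 1 = k + 1 - c := by push_cast; ring
    rw [e] at h4
    rw [norm_mul]
    calc ‖E s‖ * ‖mellin ψ s‖ ≤ M * (1 + |t|) ^ k * ‖mellin ψ s‖ := by gcongr
      _ = M * ((1 + |t|) ^ (k + 2) * ‖mellin ψ s‖) * ((1 + |t|) ^ 2)⁻¹ := by
          rw [pow_add]; field_simp
      _ ≤ M * (K * 2 ^ c * (n : ℝ) ^ (k + 1 - c)) * ((1 + |t|) ^ 2)⁻¹ := by gcongr
      _ ≤ _ := mul_le_mul_of_nonneg_left (inv_one_add_abs_sq_le _) (by positivity)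
  have hfin := norm_integral_le_of_norm_le
    (integrable_inv_one_add_sq.const_mul (M * (K * 2 ^ c * (n : ℝ) ^ (k + 1 - c))))
    (Eventually.of_forall hpt)
  rw [hshift, integral_const_mul, integral_univ_inv_one_add_sq] at hfin
  simp only [norm_mul, norm_pow, norm_neg, norm_one, one_pow, mul_one, Complex.norm_real,
    Complex.norm_ofNat, Real.norm_of_nonneg Real.pi_pos.le] at hfin
  have hA : 0 ≤ M * (K * 2 ^ c * (n : ℝ) ^ (k + 1 - c)) := by positivity
  have h2 : ‖a n‖ ≤ M * (K * 2 ^ c * (n : ℝ) ^ (k + 1 - c)) := by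
    have hp := Real.pi_pos
    have : Real.pi * (2 * ‖a n‖) ≤ Real.pi * (M * (K * 2 ^ c * (n : ℝ) ^ (k + 1 - c))) := by
      linarith
    have := le_of_mul_le_mul_left this hp
    linarith [norm_nonneg (a n)]
  calc _ ≤ _ := h2
    _ = _ := by ring

end Selberg

/-! ### Euler products: the last coefficient of a Dirichlet polynomial -/

namespace Selberg

open Polynomial
open scoped Topology

lemma _root_.Polynomial.hasSum_coeff_mul_pow (P : ℂ[X]) (x : ℂ) :
    HasSum (fun k => P.coeff k * x ^ k) (P.eval x) := by
  rw [eval_eq_sum, Polynomial.sum_def]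
  exact hasSum_sum_of_ne_finset_zero fun k hk => by
    rw [notMem_support_iff.1 hk, zero_mul]

lemma summable_succ_mul_pow {β : ℕ → ℂ} {r C x : ℝ} (hr : 0 < r)
    (hβ : ∀ j, ‖β j‖ ≤ C * r ^ j) (hx : 0 ≤ x) (hxr : x * r < 1) :
    Summable fun j : ℕ => (j + 1 : ℝ) * ‖β (j + 1)‖ * x ^ j := by
  have h1 := summable_pow_mul_geometric_of_norm_lt_one 1 (r := x * r)
    (by rwa [Real.norm_of_nonneg (by positivity)])
  have h0 := summable_pow_mul_geometric_of_norm_lt_one 0 (r := x * r)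
    (by rwa [Real.norm_of_nonneg (by positivity)])
  refine Summable.of_nonneg_of_le (fun j => by positivity) (fun j => ?_)
    ((h1.add h0).mul_left (C * r))
  calc (j + 1 : ℝ) * ‖β (j + 1)‖ * x ^ j ≤ (j + 1 : ℝ) * (C * r ^ (j + 1)) * x ^ j := by
        gcongr; exact hβ _
    _ = C * r * ((j : ℝ) ^ 1 * (x * r) ^ j + (j : ℝ) ^ 0 * (x * r) ^ j) := by
        rw [mul_pow]; ring

/-- A polynomial that agrees with the exponential of a power series does not vanish in the disc
of convergence. -/
lemma one_le_norm_root_mul {P : ℂ[X]} {β : ℕ → ℂ} {r C : ℝ} (hP0 : P.coeff 0 = 1)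
    (hr : 0 < r) (hβ : ∀ j, ‖β j‖ ≤ C * r ^ j)
    (hrec : ∀ k : ℕ, P.coeff (k + 1) * (k + 1) =
      ∑ j ∈ Finset.range (k + 1), ((j + 1 : ℕ) : ℂ) * β (j + 1) * P.coeff (k - j))
    {z : ℂ} (hz : P.IsRoot z) : 1 ≤ ‖z‖ * r := by
  by_contra! hlt
  have hP : P ≠ 0 := fun h => by simp [h] at hP0
  obtain ⟨y, hy1, hy2⟩ : ∃ y, ‖z‖ < y ∧ y * r < 1 := by
    rw [← lt_div_iff₀ hr] at hlt
    obtain ⟨y, h1, h2⟩ := exists_between hlt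
    exact ⟨y, h1, (lt_div_iff₀ hr).1 h2⟩
  have hy0 : 0 ≤ y := (norm_nonneg z).trans hy1.le
  have hsum := summable_succ_mul_pow hr hβ hy0 hy2
  set B := ∑' j : ℕ, (j + 1 : ℝ) * ‖β (j + 1)‖ * y ^ j
  -- The recursion says coefficientwise that `P' = P · ∑ (j + 1) β_{j+1} x^j`, and the series is
  -- bounded by `B` on a disc that contains `z` in its interior.
  have hder : ∀ x : ℂ, ‖x‖ ≤ y → ‖(derivative P).eval x‖ ≤ B * ‖P.eval x‖ := by
    intro x hx
    set f : ℕ → ℂ := fun j => ((j + 1 : ℕ) : ℂ) * β (j + 1) * x ^ j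
    have hfle : ∀ j : ℕ, ‖f j‖ ≤ (j + 1 : ℝ) * ‖β (j + 1)‖ * y ^ j := fun j => by
      simp only [f, norm_mul, norm_pow, Complex.norm_natCast]
      push_cast
      gcongr
    have hf : Summable fun j => ‖f j‖ := Summable.of_nonneg_of_le (fun _ => norm_nonneg _) hfle hsum
    have hPx := P.hasSum_coeff_mul_pow x
    have hg : Summable fun k => ‖P.coeff k * x ^ k‖ := hPx.summable.norm
    have h1 := hasSum_sum_range_mul_of_summable_norm hf hg
    have h2 := (derivative P).hasSum_coeff_mul_pow x
    have h3 : (fun n => ∑ j ∈ Finset.range (n + 1), f j * (P.coeff (n - j) * x ^ (n - j)))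
        = fun k => (derivative P).coeff k * x ^ k := by
      funext k
      rw [coeff_derivative, hrec k, Finset.sum_mul]
      refine Finset.sum_congr rfl fun j hj => ?_
      have : x ^ k = x ^ j * x ^ (k - j) := by
        rw [← pow_add, Nat.add_sub_cancel' (Nat.lt_succ_iff.1 (Finset.mem_range.1 hj))]
      rw [this]
      simp only [f]
      ring
    rw [h3] at h1
    rw [h2.unique h1, hPx.tsum_eq, norm_mul]
    gcongr
    exact (norm_tsum_le_tsum_norm hf).trans (hf.tsum_le_tsum hfle hsum)
  obtain ⟨q, hq, hdvd⟩ := P.exists_eq_pow_rootMultiplicity_mul_and_not_dvd hP z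
  obtain ⟨m, hm⟩ : ∃ m, P.rootMultiplicity z = m + 1 :=
    Nat.exists_eq_add_one.2 ((rootMultiplicity_pos hP).2 hz)
  rw [hm] at hq
  have hqz : q.eval z ≠ 0 := fun h => hdvd (dvd_iff_isRoot.2 h)
  -- With `P = (x - z)^(m+1) q`, the factor `(x - z)^m` cancels from `|P'| ≤ B |P|`. Letting `x → z`
  -- gives `(m + 1) q(z) = 0`, although `q(z) ≠ 0`.
  have hev : ∀ x : ℂ, x ≠ z → ‖x‖ ≤ y →
      ‖(m + 1) * q.eval x + (x - z) * (derivative q).eval x‖ ≤ B * ‖(x - z) * q.eval x‖ := by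
    intro x hxz hxy
    have h := hder x hxy
    have hpos : 0 < ‖x - z‖ ^ m := pow_pos (norm_pos_iff.2 (sub_ne_zero.2 hxz)) m
    have e1 : (derivative P).eval x =
        (x - z) ^ m * ((m + 1) * q.eval x + (x - z) * (derivative q).eval x) := by
      rw [hq]
      simp [derivative_mul, derivative_pow]
      ring
    have e2 : P.eval x = (x - z) ^ m * ((x - z) * q.eval x) := by
      conv_lhs => rw [hq]
      simp
      ring
    rw [e1, e2, norm_mul, norm_mul _ ((x - z) * q.eval x), norm_pow, ← mul_assoc,
      mul_comm B, mul_assoc] at h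
    exact le_of_mul_le_mul_left h hpos
  have hl : Tendsto (fun x : ℂ => ‖(m + 1) * q.eval x + (x - z) * (derivative q).eval x‖)
      (𝓝[≠] z) (𝓝 ‖(m + 1) * q.eval z + (z - z) * (derivative q).eval z‖) :=
    (Continuous.tendsto (by fun_prop) z).mono_left nhdsWithin_le_nhds
  have hrr : Tendsto (fun x : ℂ => B * ‖(x - z) * q.eval x‖)
      (𝓝[≠] z) (𝓝 (B * ‖(z - z) * q.eval z‖)) :=
    (Continuous.tendsto (by fun_prop) z).mono_left nhdsWithin_le_nhds
  have hle := le_of_tendsto_of_tendsto hl hrr (by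
    have hnear : ∀ᶠ x : ℂ in 𝓝[≠] z, ‖x‖ < y :=
      (continuous_norm.tendsto z).mono_left nhdsWithin_le_nhds |>.eventually (gt_mem_nhds hy1)
    filter_upwards [self_mem_nhdsWithin, hnear] with x hx hx2 using hev x hx hx2.le)
  simp only [sub_self, zero_mul, add_zero, norm_zero, mul_zero] at hle
  have h0 : ((m : ℂ) + 1) * q.eval z = 0 := norm_le_zero_iff.1 hle
  rcases mul_eq_zero.1 h0 with h | h
  · exact Nat.cast_add_one_ne_zero m h
  · exact hqz h

/-- The constant term `1` is, up to sign, the leading coefficient times the product of the roots,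
and each root has modulus at least `1 / r`. -/
lemma norm_leadingCoeff_le {P : ℂ[X]} {β : ℕ → ℂ} {r C : ℝ} (hP0 : P.coeff 0 = 1)
    (hr : 0 < r) (hβ : ∀ j, ‖β j‖ ≤ C * r ^ j)
    (hrec : ∀ k : ℕ, P.coeff (k + 1) * (k + 1) =
      ∑ j ∈ Finset.range (k + 1), ((j + 1 : ℕ) : ℂ) * β (j + 1) * P.coeff (k - j)) :
    ‖P.leadingCoeff‖ ≤ r ^ P.natDegree := by
  have hP : P ≠ 0 := fun h => by simp [h] at hP0
  have hs : P.Splits := IsAlgClosed.splits P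
  have h := congrArg norm hs.coeff_zero_eq_leadingCoeff_mul_prod_roots
  rw [hP0, norm_mul, norm_mul, norm_pow, norm_neg, norm_one, one_pow, one_mul] at h
  have hprod : ∀ S : Multiset ℂ, (∀ z ∈ S, 1 ≤ ‖z‖ * r) → 1 ≤ ‖S.prod‖ * r ^ S.card := by
    intro S
    induction S using Multiset.induction_on with
    | empty => simp
    | cons z S ih =>
      intro hS
      have h1 := hS z (Multiset.mem_cons_self z S)
      have h2 := ih fun y hy => hS y (Multiset.mem_cons_of_mem hy)
      rw [Multiset.prod_cons, Multiset.card_cons, norm_mul, pow_succ]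
      calc (1 : ℝ) ≤ (‖z‖ * r) * (‖S.prod‖ * r ^ S.card) := one_le_mul_of_one_le_of_one_le h1 h2
        _ = _ := by ring
  have h1 := hprod P.roots fun z hz =>
    one_le_norm_root_mul hP0 hr hβ hrec ((mem_roots hP).1 hz)
  rw [← hs.natDegree_eq_card_roots] at h1
  calc ‖P.leadingCoeff‖ ≤ ‖P.leadingCoeff‖ * (‖P.roots.prod‖ * r ^ P.natDegree) :=
        le_mul_of_one_le_right (norm_nonneg _) h1
    _ = r ^ P.natDegree := by rw [← mul_assoc, ← h, one_mul]

/-- The recursion for the coefficients that comes from the logarithmic derivative. -/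
lemma coeff_mul_log_eq {a : ArithmeticFunction ℂ} {b : ℕ → ℂ} (ha : RamanujanBound a)
    (hb : ∀ s : ℂ, 1 < s.re →
      LSeriesSummable b s ∧ Complex.exp (LSeries b s) = LSeries (fun n => a n) s) (n : ℕ) :
    a n * Complex.log n = ∑ d ∈ n.divisors, a (n / d) * (b d * Complex.log d) := by
  have haa : LSeries.abscissaOfAbsConv (fun n => a n) ≤ 1 := by
    have := LSeries.abscissaOfAbsConv_le_of_forall_lt_LSeriesSummable (f := fun n => a n) (x := 1)
      fun y hy => ha.summable (by simpa using hy)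
    simpa using this
  have hab : LSeries.abscissaOfAbsConv b ≤ 1 := by
    have := LSeries.abscissaOfAbsConv_le_of_forall_lt_LSeriesSummable (f := b) (x := 1)
      fun y hy => (hb y (by simpa using hy)).1
    simpa using this
  have hlt : ∀ {f : ℕ → ℂ}, LSeries.abscissaOfAbsConv f ≤ 1 → ∀ {s : ℂ}, 1 < s.re →
      LSeries.abscissaOfAbsConv f < s.re := fun h s hs => h.trans_lt (by exact_mod_cast hs)
  have key : ∀ s : ℂ, 1 < s.re → LSeries (LSeries.logMul fun n => a n) s
      = LSeries (LSeries.convolution (fun n => a n) (LSeries.logMul b)) s := by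
    intro s hs
    rw [LSeries_convolution (hlt haa hs) (hlt (by rwa [LSeries.abscissaOfAbsConv_logMul]) hs)]
    have h1 := LSeries_hasDerivAt (hlt haa hs)
    have h2 := (LSeries_hasDerivAt (hlt hab hs)).cexp
    have heq : (fun z => Complex.exp (LSeries b z)) =ᶠ[𝓝 s] LSeries (fun n => a n) := by
      filter_upwards [(isOpen_lt continuous_const Complex.continuous_re).mem_nhds hs] with z hz
      exact (hb z hz).2
    have h3 := (h2.congr_of_eventuallyEq heq.symm).unique h1
    rw [(hb s hs).2] at h3
    linear_combination h3
  have hal : LSeries.abscissaOfAbsConv (LSeries.logMul fun n => a n) < ⊤ := by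
    rw [LSeries.abscissaOfAbsConv_logMul]
    exact haa.trans_lt (EReal.coe_lt_top 1)
  have hac : LSeries.abscissaOfAbsConv
      (LSeries.convolution (fun n => a n) (LSeries.logMul b)) < ⊤ := by
    refine (LSeries.abscissaOfAbsConv_convolution_le _ _).trans_lt (max_lt ?_ ?_)
    · exact haa.trans_lt (EReal.coe_lt_top 1)
    · rw [LSeries.abscissaOfAbsConv_logMul]
      exact hab.trans_lt (EReal.coe_lt_top 1)
  rcases eq_or_ne n 0 with rfl | hn
  · simp
  have h := LSeries.eq_of_LSeries_eventually_eq hal hac (by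
    filter_upwards [eventually_gt_atTop 1] with x hx
    exact key x (by simpa using hx)) hn
  rw [LSeries.convolution_def] at h
  simp only [LSeries.logMul] at h
  rw [mul_comm, h, Nat.sum_divisorsAntidiagonal' (f := fun i j => a i * (Complex.log j * b j))]
  exact Finset.sum_congr rfl fun d _ => by ring

lemma log_natCast_ne_zero {n : ℕ} (hn : 1 < n) : Complex.log n ≠ 0 := by
  rw [← Complex.natCast_log]
  exact_mod_cast (Real.log_pos (by exact_mod_cast hn)).ne'

/-- Strong induction on `m n`. A prime power dividing `m n` divides exactly one of `m` and `n`, so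
the recursion splits into `a m * a n * (log m + log n)`, and `log (m n)` cancels. -/
lemma isMultiplicative_of_euler {a : ArithmeticFunction ℂ} {b : ℕ → ℂ} (h1 : a 1 = 1)
    (hsupp : ∀ n, ¬ IsPrimePow n → b n = 0)
    (hrec : ∀ n : ℕ, a n * Complex.log n =
      ∑ d ∈ n.divisors, a (n / d) * (b d * Complex.log d)) : a.IsMultiplicative := by
  have hfilter : ∀ (n : ℕ) (g : ℕ → ℂ), ∑ d ∈ n.divisors, g d * (b d * Complex.log d)
      = ∑ d ∈ n.divisors with IsPrimePow d, g d * (b d * Complex.log d) := fun n g => by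
    refine (Finset.sum_filter_of_ne fun d _ hd => ?_).symm
    by_contra hp
    exact hd (by simp [hsupp d hp])
  have main : ∀ N m n : ℕ, m * n = N → m.Coprime n → a (m * n) = a m * a n := by
    intro N
    induction N using Nat.strong_induction_on with
    | _ N ih =>
      intro m n hmn hcop
      rcases Nat.eq_zero_or_pos (m * n) with h0 | hpos
      · rcases Nat.mul_eq_zero.1 h0 with rfl | rfl <;> simp
      have hm : 0 < m := Nat.pos_of_mul_pos_right hpos
      have hn : 0 < n := Nat.pos_of_mul_pos_left hpos
      rcases Nat.eq_or_lt_of_le (Nat.succ_le_of_lt hpos) with h | hlt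
      · have h' : m * n = 1 := h.symm
        obtain ⟨rfl, rfl⟩ := mul_eq_one.1 h'
        simp [h1]
      have hlog : Complex.log (m * n : ℕ) = Complex.log m + Complex.log n := by
        rw [← Complex.natCast_log, ← Complex.natCast_log, ← Complex.natCast_log, Nat.cast_mul,
          Real.log_mul (by positivity) (by positivity)]
        push_cast
        rfl
      have e := hrec (m * n)
      rw [hfilter, Nat.mul_divisors_filter_prime_pow hcop, Finset.filter_union,
        Finset.sum_union] at e
      · have e1 : ∑ d ∈ m.divisors with IsPrimePow d, a (m * n / d) * (b d * Complex.log d)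
            = a n * (a m * Complex.log m) := by
          rw [hrec m, hfilter, Finset.mul_sum]
          refine Finset.sum_congr rfl fun d hd => ?_
          obtain ⟨hd, hpp⟩ := Finset.mem_filter.1 hd
          have hdm := Nat.dvd_of_mem_divisors hd
          have hq : m * n / d = m / d * n := (Nat.div_mul_right_comm hdm n).symm
          rw [hq, ih (m / d * n) ?_ (m / d) n rfl (hcop.coprime_dvd_left (Nat.div_dvd_of_dvd hdm))]
          · ring
          · rw [← hmn]
            exact Nat.mul_lt_mul_of_pos_right (Nat.div_lt_self hm hpp.one_lt) hn
        have e2 : ∑ d ∈ n.divisors with IsPrimePow d, a (m * n / d) * (b d * Complex.log d)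
            = a m * (a n * Complex.log n) := by
          rw [hrec n, hfilter, Finset.mul_sum]
          refine Finset.sum_congr rfl fun d hd => ?_
          obtain ⟨hd, hpp⟩ := Finset.mem_filter.1 hd
          have hdn := Nat.dvd_of_mem_divisors hd
          have hq : m * n / d = m * (n / d) := Nat.mul_div_assoc m hdn
          rw [hq, ih (m * (n / d)) ?_ m (n / d) rfl
            (hcop.coprime_dvd_right (Nat.div_dvd_of_dvd hdn))]
          · ring
          · rw [← hmn]
            exact Nat.mul_lt_mul_of_pos_left (Nat.div_lt_self hn hpp.one_lt) hm
        rw [e1, e2] at e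
        refine mul_right_cancel₀ (log_natCast_ne_zero hlt) (e.trans ?_)
        rw [hlog]
        ring
      · refine Finset.disjoint_left.2 fun d hd1 hd2 => ?_
        obtain ⟨hd1, hpp⟩ := Finset.mem_filter.1 hd1
        obtain ⟨hd2, -⟩ := Finset.mem_filter.1 hd2
        have := Nat.eq_one_of_dvd_coprimes hcop (Nat.dvd_of_mem_divisors hd1)
          (Nat.dvd_of_mem_divisors hd2)
        exact hpp.one_lt.ne' this
  exact ⟨h1, fun {m n} h => main _ m n rfl h⟩

lemma coeff_prime_pow_rec {a : ArithmeticFunction ℂ} {b : ℕ → ℂ}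
    (hrec : ∀ n : ℕ, a n * Complex.log n =
      ∑ d ∈ n.divisors, a (n / d) * (b d * Complex.log d)) {p : ℕ} (hp : p.Prime) (k : ℕ) :
    a (p ^ (k + 1)) * (k + 1) =
      ∑ j ∈ Finset.range (k + 1), ((j + 1 : ℕ) : ℂ) * b (p ^ (j + 1)) * a (p ^ (k - j)) := by
  have hlog : ∀ j : ℕ, Complex.log (p ^ j : ℕ) = j * Complex.log p := fun j => by
    rw [← Complex.natCast_log, ← Complex.natCast_log, Nat.cast_pow, Real.log_pow]
    push_cast
    rfl
  have h := hrec (p ^ (k + 1))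
  rw [Nat.sum_divisors_prime_pow hp, Finset.sum_range_succ'] at h
  simp only [hlog, pow_zero, Nat.cast_one, Complex.log_one, mul_zero, add_zero] at h
  refine mul_right_cancel₀ (log_natCast_ne_zero hp.one_lt) ?_
  rw [Finset.sum_mul]
  push_cast at h ⊢
  rw [← mul_assoc] at h
  rw [h]
  refine Finset.sum_congr rfl fun j hj => ?_
  have hj' : j ≤ k := Nat.lt_succ_iff.1 (Finset.mem_range.1 hj)
  have : p ^ (k + 1) / p ^ (j + 1) = p ^ (k - j) := by
    rw [Nat.pow_div (by omega) hp.pos]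
    congr 1
    omega
  rw [this]
  ring

/-- The vanishing hypothesis makes the local factor at `p` a polynomial of degree `v`, to which the
leading coefficient bound applies with `r = p^θ`. -/
lemma norm_coeff_prime_pow_le {a : ArithmeticFunction ℂ} {b : ℕ → ℂ} (h1 : a 1 = 1)
    {θ : ℝ} (hθ : b =O[atTop] fun n : ℕ => (n : ℝ) ^ θ)
    (hrec : ∀ n : ℕ, a n * Complex.log n =
      ∑ d ∈ n.divisors, a (n / d) * (b d * Complex.log d)) {p : ℕ} (hp : p.Prime) {v : ℕ}
    (hv : a (p ^ v) ≠ 0) (hmax : ∀ u, v < u → a (p ^ u) = 0) :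
    ‖a (p ^ v)‖ ≤ ((p ^ v : ℕ) : ℝ) ^ θ := by
  obtain ⟨C, -, hbd⟩ := bound_of_isBigO_nat_atTop hθ
  have hp0 : (0 : ℝ) < p := by exact_mod_cast hp.pos
  have hβ : ∀ j : ℕ, ‖b (p ^ j)‖ ≤ C * ((p : ℝ) ^ θ) ^ j := fun j => by
    have hpj : (0 : ℝ) < ((p ^ j : ℕ) : ℝ) := by exact_mod_cast pow_pos hp.pos j
    have := hbd (x := p ^ j) (Real.rpow_pos_of_pos hpj θ).ne'
    rw [Real.norm_of_nonneg (Real.rpow_nonneg hpj.le _)] at this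
    refine this.trans_eq ?_
    rw [Nat.cast_pow, ← Real.rpow_natCast, ← Real.rpow_mul hp0.le, ← Real.rpow_natCast,
      ← Real.rpow_mul hp0.le, mul_comm θ]
  set P : ℂ[X] := ∑ k ∈ Finset.range (v + 1), monomial k (a (p ^ k)) with hP
  have hcoeff : ∀ k, P.coeff k = a (p ^ k) := fun k => by
    rw [hP, finsetSum_coeff]
    simp only [coeff_monomial, Finset.sum_ite_eq', Finset.mem_range]
    split_ifs with h
    · rfl
    · exact (hmax k (by omega)).symm
  have hdeg : P.natDegree = v := natDegree_eq_of_le_of_coeff_ne_zero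
    (natDegree_le_iff_coeff_eq_zero.2 fun u hu => by rw [hcoeff, hmax u hu])
    (by rwa [hcoeff])
  have h := norm_leadingCoeff_le (P := P) (β := fun j => b (p ^ j)) (by simp [hcoeff, h1])
    (Real.rpow_pos_of_pos hp0 θ) hβ (fun k => by
      simp only [hcoeff]
      exact coeff_prime_pow_rec hrec hp k)
  rw [leadingCoeff, hdeg, hcoeff] at h
  refine h.trans_eq ?_
  rw [Nat.cast_pow, ← Real.rpow_natCast, ← Real.rpow_mul hp0.le, ← Real.rpow_natCast,
    ← Real.rpow_mul hp0.le, mul_comm θ]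

/-- The last coefficient of a Dirichlet polynomial with an Euler product is small. -/
lemma norm_last_coeff_le {a : ArithmeticFunction ℂ} (ha : RamanujanBound a)
    (hE : HasEulerProduct a) {N : ℕ} (hN : a N ≠ 0) (hmax : ∀ n, N < n → a n = 0) :
    ∃ θ : ℝ, θ < 1 / 2 ∧ ‖a N‖ ≤ (N : ℝ) ^ θ := by
  obtain ⟨h1, b, hsupp, ⟨θ, hθ, hbO⟩, hb⟩ := hE
  have hrec := coeff_mul_log_eq ha hb
  have hmul := isMultiplicative_of_euler h1 hsupp hrec
  have hN0 : N ≠ 0 := fun h => hN (by simp [h])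
  refine ⟨θ, hθ, ?_⟩
  have hfac := hmul.multiplicative_factorization a hN0
  have hNprod : (N : ℝ) ^ θ = N.factorization.prod fun p k => ((p ^ k : ℕ) : ℝ) ^ θ := by
    conv_lhs => rw [← Nat.prod_factorization_pow_eq_self hN0]
    rw [Finsupp.prod, Finsupp.prod, Nat.cast_prod, Real.finsetProd_rpow]
    exact fun p _ => Nat.cast_nonneg _
  rw [hfac, hNprod, Finsupp.prod, Finsupp.prod, norm_prod]
  refine Finset.prod_le_prod (fun _ _ => norm_nonneg _) fun p hp => ?_
  have hpp := Nat.prime_of_mem_primeFactors (by simpa using hp)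
  have hsplit : p ^ N.factorization p * (N / p ^ N.factorization p) = N := Nat.ordProj_mul_ordCompl_eq_self N p
  have hcop : ∀ u, (p ^ u).Coprime (N / p ^ N.factorization p) := fun u =>
    Nat.Coprime.pow_left u (Nat.coprime_ordCompl hpp hN0)
  have hN' := hmul.2 (hcop (N.factorization p))
  rw [hsplit] at hN'
  have hne : a (p ^ N.factorization p) ≠ 0 := fun h => hN (by rw [hN', h, zero_mul])
  have hne' : a (N / p ^ N.factorization p) ≠ 0 := fun h => hN (by rw [hN', h, mul_zero])
  refine norm_coeff_prime_pow_le h1 hbO hrec hpp hne fun u hu => ?_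
  -- Raising the power of `p` while keeping the cofactor of `N` passes beyond `N`, where
  -- coefficients vanish; since the cofactor's coefficient is nonzero, `a (p ^ u)` must vanish.
  have hlt : N < p ^ u * (N / p ^ N.factorization p) := by
    conv_lhs => rw [← hsplit]
    refine Nat.mul_lt_mul_of_pos_right (Nat.pow_lt_pow_right hpp.one_lt hu) ?_
    exact Nat.ordCompl_pos p hN0
  have h0 := hmax _ hlt
  rw [hmul.2 (hcop u)] at h0
  exact (mul_eq_zero.1 h0).resolve_right hne'

end Selberg

/-! ### Degree less than one is trivial -/

namespace Selberg

open scoped Topology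

/-- A Dirichlet series that converges everywhere represents its continuation. -/
lemma continuation_eq_LSeries {a : ℕ → ℂ} {E : ℂ → ℂ} {m : ℕ} (hE : Differentiable ℂ E)
    (ha : ∀ s : ℂ, LSeriesSummable a s)
    (hEa : ∀ s : ℂ, 1 < s.re → E s = (s - 1) ^ m * LSeries a s) (s : ℂ) :
    E s = (s - 1) ^ m * LSeries a s := by
  have hab : ∀ s : ℂ, LSeries.abscissaOfAbsConv a < s.re := fun s => by
    have h := (ha (s - 1)).abscissaOfAbsConv_le
    refine h.trans_lt ?_
    exact_mod_cast (by simp : (s - 1).re < s.re)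
  have hL : Differentiable ℂ (LSeries a) := fun s => (LSeries_hasDerivAt (hab s)).differentiableAt
  have hR : Differentiable ℂ fun s => (s - 1) ^ m * LSeries a s :=
    ((differentiable_id.sub_const 1).pow m).mul hL
  have h := (hE.differentiableOn.analyticOnNhd isOpen_univ).eq_of_eventuallyEq
    (hR.differentiableOn.analyticOnNhd isOpen_univ) (z₀ := 2) (by
      filter_upwards [(isOpen_lt continuous_const Complex.continuous_re).mem_nhds
        (show (1 : ℝ) < (2 : ℂ).re by norm_num)] with z hz
      exact hEa z hz)
  exact congrFun h s

lemma exists_norm_le_of_abs_im_le {E : ℂ → ℂ} (hE : Continuous E) (c T : ℝ) :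
    ∃ M : ℝ, 0 ≤ M ∧ ∀ s : ℂ, s.re = c → |s.im| ≤ T → ‖E s‖ ≤ M := by
  have hK : IsCompact (Set.Icc c c ×ℂ Set.Icc (-T) T) := isCompact_Icc.reProdIm isCompact_Icc
  obtain ⟨M, hM⟩ := hK.exists_bound_of_continuousOn hE.continuousOn
  refine ⟨max M 0, le_max_right _ _, fun s hs hT => (hM s ?_).trans (le_max_left _ _)⟩
  rw [Complex.mem_reProdIm]
  exact ⟨⟨hs.ge, hs.le⟩, abs_le.1 hT⟩

lemma exists_polynomial_bound_of_hasLeftGrowth {F E : ℂ → ℂ} {m : ℕ} {d : ℝ}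
    (hE : Differentiable ℂ E) (hEF : ∀ s : ℂ, s ≠ 1 → E s = (s - 1) ^ m * F s)
    (hd : 0 ≤ d) (hg : HasLeftGrowth F d) :
    ∃ B : ℝ, 0 ≤ B ∧ ∀ c : ℝ, 0 < c → ∃ (k : ℕ) (M : ℝ), (k : ℝ) ≤ d * c + B ∧
      ∀ s : ℂ, s.re = -c → ‖E s‖ ≤ M * (1 + |s.im|) ^ k := by
  obtain ⟨B, hB⟩ := hg
  refine ⟨|B| + 1 + m, by positivity, fun c hc => ?_⟩
  obtain ⟨C, hC, T, hT1, h⟩ := hB c hc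
  obtain ⟨M, hM0, hM⟩ := exists_norm_le_of_abs_im_le hE.continuous (-c) T
  have hdc : 0 ≤ d * c := by positivity
  set j := ⌈d * c + |B|⌉₊
  have hj1 : d * c + |B| ≤ j := Nat.le_ceil _
  have hj2 : (j : ℝ) < d * c + |B| + 1 := Nat.ceil_lt_add_one (by positivity)
  refine ⟨j + m, M + C * (2 + c) ^ m, by push_cast; linarith, fun s hs => ?_⟩
  have hs0 := abs_nonneg s.im
  have h1p : (1 : ℝ) ≤ (1 + |s.im|) ^ (j + m) := one_le_pow₀ (by linarith)
  rcases le_total |s.im| T with hle | hle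
  · calc ‖E s‖ ≤ M := hM s hs hle
      _ ≤ M * (1 + |s.im|) ^ (j + m) := le_mul_of_one_le_right hM0 h1p
      _ ≤ _ := by
          gcongr
          have : 0 ≤ C * (2 + c) ^ m := by positivity
          linarith
  · have ht1 : 1 ≤ |s.im| := hT1.trans hle
    have hne : s ≠ 1 := fun h0 => by rw [h0] at hs; simp at hs; linarith
    have hF := (h s hs hle).2
    have hn : ‖s - 1‖ ≤ (2 + c) * (1 + |s.im|) := by
      refine (Complex.norm_le_abs_re_add_abs_im _).trans ?_
      simp only [Complex.sub_re, Complex.one_re, Complex.sub_im, Complex.one_im, sub_zero, hs]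
      rw [abs_of_nonpos (by linarith)]
      nlinarith
    have hpow : |s.im| ^ (d * c + B) ≤ (1 + |s.im|) ^ j := by
      calc |s.im| ^ (d * c + B) ≤ |s.im| ^ (j : ℝ) :=
            Real.rpow_le_rpow_of_exponent_le ht1 (by linarith [le_abs_self B])
        _ = |s.im| ^ j := Real.rpow_natCast _ _
        _ ≤ _ := by gcongr; linarith
    rw [hEF s hne, norm_mul, norm_pow]
    calc ‖s - 1‖ ^ m * ‖F s‖ ≤ ((2 + c) * (1 + |s.im|)) ^ m * (C * (1 + |s.im|) ^ j) := by
          gcongr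
          exact hF.trans (by gcongr)
      _ = C * (2 + c) ^ m * (1 + |s.im|) ^ (j + m) := by rw [mul_pow, pow_add]; ring
      _ ≤ _ := by
          gcongr
          linarith

/-- If the degree is less than `1`, then the Dirichlet series converges everywhere. -/
lemma summable_of_hasLeftGrowth_lt_one {a : ℕ → ℂ} {F E : ℂ → ℂ} {m : ℕ} {d : ℝ}
    (ha : ∀ s : ℂ, 1 < s.re → LSeriesSummable a s)
    (hF : ∀ s : ℂ, 1 < s.re → F s = LSeries a s)
    (hE : Differentiable ℂ E) (hfo : HasFiniteOrder E)
    (hEF : ∀ s : ℂ, s ≠ 1 → E s = (s - 1) ^ m * F s)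
    (hd : 0 ≤ d) (hd1 : d < 1) (hg : HasLeftGrowth F d) (s : ℂ) : LSeriesSummable a s := by
  obtain ⟨B, hB0, hB⟩ := exists_polynomial_bound_of_hasLeftGrowth hE hEF hd hg
  -- Since `k ≤ d c + B`, the exponent `k + 1 - c` is at most `-|Re s| - 3`, which suffices for
  -- convergence at `s`. Solving for `c` needs `d < 1`.
  set c : ℝ := (|s.re| + B + 4) / (1 - d)
  have h1d : 0 < 1 - d := by linarith
  have hc : 0 < c := by positivity
  have hcd : c - d * c = |s.re| + B + 4 := by
    simp only [c]; field_simp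
  obtain ⟨k, M, hk, hM⟩ := hB c hc
  obtain ⟨K, -, hcoef⟩ := exists_norm_coeff_le k
  have h := hcoef a E m c M hE hfo (ha _ (by norm_num)) (fun z hz => by
    rw [hEF z (fun h0 => by rw [h0] at hz; norm_num at hz), hF z (by rw [hz]; norm_num)]) hc hM
  refine LSeriesSummable_of_isBigO_rpow (x := s.re - 1) (by linarith) ?_
  refine IsBigO.of_bound (K * M * 2 ^ c) ?_
  filter_upwards [eventually_ge_atTop 1] with n hn
  have hn1 : (1 : ℝ) ≤ n := by exact_mod_cast hn
  have hM0 : 0 ≤ K * M * 2 ^ c := by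
    have := (norm_nonneg _).trans (h 1 le_rfl)
    simpa using this
  rw [Real.norm_of_nonneg (by positivity)]
  refine (h n hn).trans (mul_le_mul_of_nonneg_left
    (Real.rpow_le_rpow_of_exponent_le hn1 ?_) hM0)
  linarith [neg_abs_le s.re]

/-- An absolutely convergent Dirichlet series is bounded on each vertical line. If `d > 0`, then `c
= (1 + |B|) / d` gives `d c - B ≥ 1`, hence at least linear growth on `Re s = -c`. -/
lemma hasLeftGrowth_eq_zero_of_summable {a : ℕ → ℂ} {F E : ℂ → ℂ} {m : ℕ} {d : ℝ}
    (ha : ∀ s : ℂ, LSeriesSummable a s)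
    (hF : ∀ s : ℂ, 1 < s.re → F s = LSeries a s) (hE : Differentiable ℂ E)
    (hEF : ∀ s : ℂ, s ≠ 1 → E s = (s - 1) ^ m * F s)
    (hd : 0 ≤ d) (hg : HasLeftGrowth F d) : d = 0 := by
  by_contra hne
  have hd0 : 0 < d := lt_of_le_of_ne hd (Ne.symm hne)
  obtain ⟨B, hB⟩ := hg
  set c := (1 + |B|) / d
  have hc : 0 < c := by positivity
  have hdc : d * c = 1 + |B| := by simp only [c]; field_simp
  obtain ⟨C, hC, T, hT1, h⟩ := hB c hc
  set M := ∑' n, ‖LSeries.term a ((-c : ℝ) : ℂ) n‖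
  have hM0 : 0 ≤ M := tsum_nonneg fun _ => norm_nonneg _
  set t : ℝ := T + C * M + 1
  have ht : T ≤ t := by simp only [t]; nlinarith
  have ht1 : 1 ≤ t := hT1.trans ht
  set s : ℂ := (-c : ℝ) + t * Complex.I
  have hsre : s.re = -c := by simp [s]
  have hsim : s.im = t := by simp [s]
  have hs1 : s ≠ 1 := fun h0 => by rw [h0] at hsre; simp at hsre; linarith
  have hlow := (h s hsre (by rw [hsim, abs_of_pos (by linarith)]; exact ht)).1
  rw [hsim, abs_of_pos (by linarith)] at hlow
  have hFs : F s = LSeries a s := by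
    have h1 := continuation_eq_LSeries (m := m) hE ha (fun z hz => by
      rw [hEF z (fun h0 => by rw [h0] at hz; norm_num at hz), hF z hz]) s
    rw [hEF s hs1] at h1
    exact mul_left_cancel₀ (pow_ne_zero _ (sub_ne_zero.2 hs1)) h1
  have h2 : ‖F s‖ ≤ M := by
    rw [hFs]
    exact norm_LSeries_le_tsum (ha _) hsre
  have h3 : t ≤ t ^ (d * c - B) := by
    conv_lhs => rw [← Real.rpow_one t]
    exact Real.rpow_le_rpow_of_exponent_le ht1 (by linarith [le_abs_self B])
  have h4 : C * ‖F s‖ ≤ C * M := by gcongr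
  have : T + C * M + 1 ≤ C * M := h3.trans (hlow.trans h4)
  linarith

section DegreeZero

variable {a : ArithmeticFunction ℂ} {F E : ℂ → ℂ} {m : ℕ} {Q : ℝ}

/-- A Dirichlet series satisfying a functional equation without gamma factors is a polynomial. -/
lemma coeff_eq_zero_of_reflection (ha : RamanujanBound a)
    (hF : ∀ s : ℂ, 1 < s.re → F s = LSeries (fun n => a n) s)
    (hE : Differentiable ℂ E) (hfo : HasFiniteOrder E)
    (hEF : ∀ s : ℂ, s ≠ 1 → E s = (s - 1) ^ m * F s) (hQ : 0 < Q)
    (hfe : ∀ s : ℂ, s.re < 0 → ‖F s‖ = Q ^ (1 - 2 * s.re) * ‖F (1 - conj s)‖)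
    {n : ℕ} (hn : 2 * Q ^ 2 < n) : a n = 0 := by
  have hn0 : (0 : ℝ) < n := lt_trans (by positivity) hn
  have hn1 : 1 ≤ n := by exact_mod_cast hn0
  -- Without gamma factors `E` grows like `|t|^m` on every line `Re s = -j`, so `K` does not change
  -- as `j → ∞`. The bound becomes a constant times `j^m (2 Q² / n)^j`, which tends to `0`.
  obtain ⟨K, hK, hcoef⟩ := exists_norm_coeff_le m
  set M₀ := ∑' n, ‖LSeries.term (fun n => a n) ((2 : ℝ) : ℂ) n‖
  have hM₀ : 0 ≤ M₀ := tsum_nonneg fun _ => norm_nonneg _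
  have h2 := ha.summable (s := (2 : ℝ)) (by norm_num)
  have hbound : ∀ j : ℕ, 1 ≤ j → ‖a n‖ ≤
      K * (2 ^ m * Q * M₀) * (n : ℝ) ^ (m + 1 : ℝ) * ((j : ℝ) ^ m * (2 * Q ^ 2 / n) ^ j) := by
    intro j hj
    have hj1 : (1 : ℝ) ≤ j := by exact_mod_cast hj
    have hj0 : (0 : ℝ) < j := by linarith
    have h := hcoef (fun n => a n) E m j ((2 * j) ^ m * Q ^ (1 + 2 * (j : ℝ)) * M₀) hE hfo h2
      (fun z hz => by
        rw [hEF z (fun h0 => by rw [h0] at hz; norm_num at hz), hF z (by rw [hz]; norm_num)])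
      hj0 (fun s hs => by
        have hre : (1 - conj s).re = 1 + j := by simp [hs]
        have hs1 : s ≠ 1 := fun h0 => by rw [h0] at hs; simp at hs; linarith
        have hF' : ‖F (1 - conj s)‖ ≤ M₀ := by
          rw [hF _ (by rw [hre]; linarith)]
          have hsum := ha.summable (s := ((1 + j : ℝ) : ℂ)) (by simpa using hj0)
          refine (norm_LSeries_le_tsum hsum hre).trans ?_
          refine hsum.norm.tsum_le_tsum (fun l => ?_) h2.norm
          exact LSeries.norm_term_le_of_re_le_re _
            (by rw [Complex.ofReal_re, Complex.ofReal_re]; linarith) l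
        have hnorm : ‖s - 1‖ ≤ 2 * j * (1 + |s.im|) := by
          refine (Complex.norm_le_abs_re_add_abs_im _).trans ?_
          simp only [Complex.sub_re, Complex.one_re, Complex.sub_im, Complex.one_im, sub_zero, hs]
          rw [abs_of_nonpos (by linarith)]
          nlinarith [abs_nonneg s.im]
        rw [hEF s hs1, norm_mul, norm_pow, hfe s (by rw [hs]; linarith), hs,
          show 1 - 2 * -(j : ℝ) = 1 + 2 * j by ring]
        calc ‖s - 1‖ ^ m * (Q ^ (1 + 2 * (j : ℝ)) * ‖F (1 - conj s)‖)
            ≤ (2 * j * (1 + |s.im|)) ^ m * (Q ^ (1 + 2 * (j : ℝ)) * M₀) := by gcongr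
          _ = _ := by rw [mul_pow (2 * (j : ℝ))]; ring) n hn1
    refine h.trans_eq ?_
    have e1 : Q ^ (1 + 2 * (j : ℝ)) = Q * (Q ^ 2) ^ j := by
      rw [Real.rpow_add hQ, Real.rpow_one, Real.rpow_mul hQ.le, Real.rpow_natCast]
      norm_num
    have e2 : (n : ℝ) ^ ((m : ℝ) + 1 - j) = (n : ℝ) ^ (m + 1 : ℝ) / (n : ℝ) ^ j := by
      rw [Real.rpow_sub hn0, Real.rpow_natCast]
    rw [e1, e2, Real.rpow_natCast, mul_pow, div_pow, mul_pow]
    field_simp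
  have hr : |2 * Q ^ 2 / n| < 1 := by
    rw [abs_of_pos (by positivity), div_lt_one hn0]
    exact hn
  have hlim := (tendsto_pow_const_mul_const_pow_of_abs_lt_one m hr).const_mul
    (K * (2 ^ m * Q * M₀) * (n : ℝ) ^ (m + 1 : ℝ))
  rw [mul_zero] at hlim
  have := ge_of_tendsto hlim (by
    filter_upwards [eventually_ge_atTop 1] with j hj using hbound j hj)
  exact norm_le_zero_iff.1 this

lemma LSeriesSummable_of_finite {b : ℕ → ℂ} {N : ℕ} (hb : ∀ n, N < n → b n = 0) (s : ℂ) :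
    LSeriesSummable b s :=
  summable_of_ne_finset_zero (s := Finset.range (N + 1)) fun n hn => by
    rw [LSeries.term_def, hb n (by simpa using hn)]
    simp

lemma LSeries_of_finite {b : ℕ → ℂ} {N : ℕ} (hb : ∀ n, N < n → b n = 0) (s : ℂ) :
    LSeries b s = ∑ n ∈ Finset.range (N + 1), LSeries.term b s n :=
  tsum_eq_sum fun n hn => by
    rw [LSeries.term_def, hb n (by simpa using hn)]
    simp

/-- The last coefficient of a Dirichlet polynomial governs its growth to the left. -/
lemma tendsto_norm_LSeries_neg_div {b : ℕ → ℂ} {N : ℕ} (hN : N ≠ 0)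
    (hb : ∀ n, N < n → b n = 0) :
    Tendsto (fun j : ℕ => ‖LSeries b (-(j : ℂ))‖ / (N : ℝ) ^ j) atTop (𝓝 ‖b N‖) := by
  have hN0 : (N : ℂ) ≠ 0 := by exact_mod_cast hN
  have h : Tendsto (fun j : ℕ => LSeries b (-(j : ℂ)) / (N : ℂ) ^ j) atTop (𝓝 (b N)) := by
    have h1 : ∀ n ∈ Finset.range (N + 1), Tendsto
        (fun j : ℕ => LSeries.term b (-(j : ℂ)) n / (N : ℂ) ^ j) atTop
        (𝓝 (if n = N then b N else 0)) := by
      intro n hn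
      rcases eq_or_ne n 0 with rfl | hn0
      · simp [hN.symm]
      have e : ∀ j : ℕ, LSeries.term b (-(j : ℂ)) n / (N : ℂ) ^ j
          = b n * ((n : ℂ) / N) ^ j := fun j => by
        rw [LSeries.term_of_ne_zero hn0, Complex.cpow_neg, Complex.cpow_natCast, div_inv_eq_mul,
          div_pow]
        ring
      simp_rw [e]
      split_ifs with hnN
      · subst hnN
        simp [hN0]
      · have hlt : (n : ℝ) < N := by
          have := Finset.mem_range.1 hn
          exact_mod_cast (by omega : n < N)
        have : ‖(n : ℂ) / N‖ < 1 := by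
          rw [norm_div, Complex.norm_natCast, Complex.norm_natCast,
            div_lt_one (lt_of_le_of_lt (Nat.cast_nonneg n) hlt)]
          exact hlt
        simpa using (tendsto_pow_atTop_nhds_zero_of_norm_lt_one this).const_mul (b n)
    have h2 := tendsto_finsetSum _ h1
    simp only [Finset.sum_ite_eq', Finset.mem_range, Nat.lt_succ_self, if_true] at h2
    simpa only [LSeries_of_finite hb, Finset.sum_div] using h2
  simpa using h.norm

/-- At `s = -j` the left side of the reflection is asymptotically `|a_N| N^j`, and the right side is
`Q^(1 + 2j)` since `F(1 + j) → a₁ = 1`. So `Q (Q² / N)^j` has a nonzero limit, which forces `Q² = N`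
and `|a_N| = Q`. -/
lemma norm_last_coeff_eq_sqrt (h1 : a 1 = 1)
    (hF : ∀ s : ℂ, 1 < s.re → F s = LSeries (fun n => a n) s)
    (hE : Differentiable ℂ E)
    (hEF : ∀ s : ℂ, s ≠ 1 → E s = (s - 1) ^ m * F s) (hQ : 0 < Q)
    (hfe : ∀ s : ℂ, s.re < 0 → ‖F s‖ = Q ^ (1 - 2 * s.re) * ‖F (1 - conj s)‖)
    {N : ℕ} (hN : a N ≠ 0) (hmax : ∀ n, N < n → a n = 0) : ‖a N‖ = (N : ℝ) ^ (1 / 2 : ℝ) := by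
  have hN0 : N ≠ 0 := fun h => hN (by simp [h])
  have hNpos : (0 : ℝ) < N := by exact_mod_cast Nat.pos_of_ne_zero hN0
  have hsum := LSeriesSummable_of_finite (b := fun n => a n) hmax
  have hFL : ∀ s : ℂ, s ≠ 1 → F s = LSeries (fun n => a n) s := fun s hs => by
    have h := continuation_eq_LSeries (m := m) hE hsum (fun z hz => by
      rw [hEF z (fun h0 => by rw [h0] at hz; norm_num at hz), hF z hz]) s
    rw [hEF s hs] at h
    exact mul_left_cancel₀ (pow_ne_zero _ (sub_ne_zero.2 hs)) h
  have hlim1 := tendsto_norm_LSeries_neg_div (b := fun n => a n) hN0 hmax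
  have hab : LSeries.abscissaOfAbsConv (fun n => a n) < ⊤ :=
    (hsum 0).abscissaOfAbsConv_le.trans_lt (EReal.coe_lt_top _)
  have hlim2 : Tendsto (fun j : ℕ => ‖LSeries (fun n => a n) ((1 + j : ℝ) : ℂ)‖) atTop (𝓝 1) := by
    have := ((LSeries.tendsto_atTop hab).comp
      (tendsto_atTop_add_const_left atTop (1 : ℝ) tendsto_natCast_atTop_atTop)).norm
    rw [h1, norm_one] at this
    exact this
  have heq : ∀ j : ℕ, 1 ≤ j → ‖LSeries (fun n => a n) (-(j : ℂ))‖ / (N : ℝ) ^ j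
      = Q * (Q ^ 2 / N) ^ j * ‖LSeries (fun n => a n) ((1 + j : ℝ) : ℂ)‖ := by
    intro j hj
    have hj0 : (0 : ℝ) < j := by exact_mod_cast hj
    have hne1 : -(j : ℂ) ≠ 1 := fun h => by
      have := congrArg Complex.re h
      simp at this
      linarith
    have hne2 : ((1 + j : ℝ) : ℂ) ≠ 1 := fun h => by
      have := congrArg Complex.re h
      simp at this
      omega
    have h := hfe (-(j : ℂ)) (by simpa using hj0)
    have e : 1 - conj (-(j : ℂ)) = ((1 + j : ℝ) : ℂ) := by simp
    have e2 : Q ^ (1 - 2 * (-(j : ℂ)).re) = Q * (Q ^ 2) ^ j := by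
      have : 1 - 2 * (-(j : ℂ)).re = 1 + 2 * (j : ℝ) := by simp
      rw [this, Real.rpow_add hQ, Real.rpow_one, Real.rpow_mul hQ.le, Real.rpow_natCast]
      norm_num
    rw [e, e2, hFL _ hne1, hFL _ hne2] at h
    rw [h, div_pow]
    ring
  have hlim3 : Tendsto (fun j : ℕ => Q * (Q ^ 2 / N) ^ j) atTop (𝓝 ‖a N‖) := by
    have h := (hlim1.div hlim2 one_ne_zero)
    rw [div_one] at h
    refine h.congr' ?_
    filter_upwards [eventually_ge_atTop 1, hlim2.eventually_ne one_ne_zero] with j hj hne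
    simp only [Pi.div_apply]
    rw [heq j hj, mul_div_assoc, div_self hne, mul_one]
  have hpos : 0 < ‖a N‖ := norm_pos_iff.2 hN
  have hr0 : 0 < Q ^ 2 / N := by positivity
  rcases lt_trichotomy (Q ^ 2 / N) 1 with hlt | heq1 | hgt
  · have h := (tendsto_pow_atTop_nhds_zero_of_lt_one hr0.le hlt).const_mul Q
    rw [mul_zero] at h
    exact absurd (tendsto_nhds_unique hlim3 h) hpos.ne'
  · have hQN : ‖a N‖ = Q := by
      refine tendsto_nhds_unique hlim3 ?_
      simp [heq1]
    have hQ2 : Q ^ 2 = N := by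
      rwa [div_eq_one_iff_eq hNpos.ne'] at heq1
    rw [hQN, ← hQ2, ← Real.sqrt_eq_rpow, Real.sqrt_sq hQ.le]
  · exact absurd hlim3 (not_tendsto_nhds_of_tendsto_atTop
      ((tendsto_pow_atTop_atTop_of_one_lt hgt).const_mul_atTop hQ) _)

end DegreeZero

/-- The elements of the Selberg class of degree less than `1` are trivial. -/
lemma eq_one_or_exists_hasLeftGrowth {a : ArithmeticFunction ℂ} (ha : RamanujanBound a)
    (hE : HasEulerProduct a) {F : ℂ → ℂ}
    (hF : ∀ s : ℂ, 1 < s.re → F s = LSeries (fun n => a n) s)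
    (hcont : IsAnalyticAwayFromOne F) (hfe : HasFunctionalEquation F) :
    a = 1 ∨ ∃ d : ℝ, 1 ≤ d ∧ HasLeftGrowth F d := by
  obtain ⟨m, E, hEd, hfo, hEF⟩ := hcont
  obtain ⟨ε, Q, k, w, μ, hε, hQ, hw, -, hfe⟩ := hfe
  have hg := hasLeftGrowth_of_functionalEquation ha hE hF hε hQ hw hfe
  rcases le_or_gt 1 (2 * ∑ i, w i) with hd | hd
  · exact Or.inr ⟨_, hd, hg⟩
  left
  have hd0 : 0 ≤ 2 * ∑ i, w i :=
    mul_nonneg zero_le_two (Finset.sum_nonneg fun i _ => (hw i).le)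
  have hsum := summable_of_hasLeftGrowth_lt_one (fun s hs => ha.summable hs) hF hEd hfo hEF
    hd0 hd hg
  have hzero := hasLeftGrowth_eq_zero_of_summable hsum hF hEd hEF hd0 hg
  obtain rfl : k = 0 := by
    by_contra hk
    have : Nonempty (Fin k) := ⟨⟨0, Nat.pos_of_ne_zero hk⟩⟩
    have := Finset.sum_pos (fun i _ => hw i) (Finset.univ_nonempty (α := Fin k))
    linarith
  have hrefl : ∀ s : ℂ, s.re < 0 → ‖F s‖ = Q ^ (1 - 2 * s.re) * ‖F (1 - conj s)‖ := by
    intro s hs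
    have h := congrArg norm (hfe s
      ⟨fun h0 => by rw [h0] at hs; norm_num at hs, fun i => i.elim0⟩
      ⟨fun h0 => by
        have := congrArg Complex.re h0
        simp at this
        linarith, fun i => i.elim0⟩)
    rw [Complex.norm_conj, norm_mul, norm_mul, norm_gammaFactor hε hQ, norm_gammaFactor hε hQ] at h
    simp only [Finset.univ_eq_empty, Finset.prod_empty, mul_one, Complex.sub_re, Complex.one_re,
      Complex.conj_re] at h
    have hq : Q ^ (1 - s.re) = Q ^ s.re * Q ^ (1 - 2 * s.re) := by
      rw [← Real.rpow_add hQ]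
      ring_nf
    rw [hq, mul_assoc] at h
    exact mul_left_cancel₀ (Real.rpow_pos_of_pos hQ _).ne' h
  have hsmall : ∀ n : ℕ, ⌊2 * Q ^ 2⌋₊ < n → a n = 0 := fun n hn =>
    coeff_eq_zero_of_reflection ha hF hEd hfo hEF hQ hrefl (Nat.lt_of_floor_lt hn)
  -- The `+ 1` keeps the index `1`, where the coefficient is nonzero, within the search range even
  -- when the floor is `0`.
  set N := Nat.findGreatest (fun n => a n ≠ 0) (⌊2 * Q ^ 2⌋₊ + 1)
  have h1 : a 1 ≠ 0 := by rw [hE.1]; exact one_ne_zero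
  have hN : a N ≠ 0 := Nat.findGreatest_spec (P := fun n => a n ≠ 0) (by omega) h1
  have hN1 : 1 ≤ N := Nat.le_findGreatest (by omega) h1
  have hmax : ∀ n, N < n → a n = 0 := fun n hn => by
    rcases le_or_gt n (⌊2 * Q ^ 2⌋₊ + 1) with h | h
    · exact not_not.1 (Nat.findGreatest_is_greatest hn h)
    · exact hsmall n (by omega)
  obtain ⟨θ, hθ, hle⟩ := norm_last_coeff_le ha hE hN hmax
  rw [norm_last_coeff_eq_sqrt hE.1 hF hEd hEF hQ hrefl hN hmax] at hle
  have hN' : N = 1 := by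
    by_contra hne
    have : (1 : ℝ) < N := by exact_mod_cast lt_of_le_of_ne hN1 (Ne.symm hne)
    exact absurd ((Real.rpow_le_rpow_left_iff this).1 hle) (by linarith)
  ext n
  rcases lt_trichotomy n 1 with h | rfl | h
  · obtain rfl : n = 0 := by omega
    simp
  · simp [hE.1]
  · rw [hmax n (by omega), ArithmeticFunction.one_apply_ne (by omega)]

end Selberg

/-! ### The degree and factorization into primitives -/

namespace Selberg

open scoped Topology

/-- `d` is the degree of the Dirichlet series with coefficients `a`, read off from the growth of
its continuation to the left. -/
def HasDegree (a : ArithmeticFunction ℂ) (d : ℝ) : Prop :=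
  ∃ (F E : ℂ → ℂ) (m : ℕ), (∀ s : ℂ, 1 < s.re → F s = LSeries (fun n => a n) s) ∧
    Differentiable ℂ E ∧ (∀ s : ℂ, s ≠ 1 → E s = (s - 1) ^ m * F s) ∧ HasLeftGrowth F d

lemma le_of_rpow_le_mul_rpow {x y K T : ℝ} (h : ∀ t : ℝ, T ≤ t → t ^ x ≤ K * t ^ y) : x ≤ y := by
  by_contra! hlt
  have h1 := tendsto_rpow_atTop (sub_pos.2 hlt)
  obtain ⟨t, ht1, ht2, ht3⟩ := ((eventually_ge_atTop T).and
    ((eventually_gt_atTop 0).and (h1.eventually_gt_atTop K))).exists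
  have h2 := h t ht1
  rw [Real.rpow_sub ht2, lt_div_iff₀ (Real.rpow_pos_of_pos ht2 y)] at ht3
  linarith

/-- The lower bound for `F` and the upper bound for `G` on `Re s = -c` give `d c - B ≤ e c + B'` for
every `c > 0`; large `c` removes the bounded errors. -/
lemma HasLeftGrowth.le {F G : ℂ → ℂ} {d e : ℝ} (hF : HasLeftGrowth F d) (hG : HasLeftGrowth G e)
    (h : ∀ s, s ≠ 1 → F s = G s) : d ≤ e := by
  obtain ⟨B, hB⟩ := hF
  obtain ⟨B', hB'⟩ := hG
  have key : ∀ c : ℝ, 0 < c → d * c - B ≤ e * c + B' := by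
    intro c hc
    obtain ⟨C, hC, T, hT, h1⟩ := hB c hc
    obtain ⟨C', hC', T', hT', h2⟩ := hB' c hc
    refine le_of_rpow_le_mul_rpow (K := C * C') (T := max T T') fun t ht => ?_
    have ht0 : 0 < t := by linarith [(le_max_left T T').trans ht]
    have hre : ((-c : ℝ) + t * Complex.I : ℂ).re = -c := by simp
    have him : ((-c : ℝ) + t * Complex.I : ℂ).im = t := by simp
    have hne : ((-c : ℝ) + t * Complex.I : ℂ) ≠ 1 := fun h0 => by
      rw [h0] at him
      simp at him
      linarith
    have k1 := (h1 _ hre (by rw [him, abs_of_pos ht0]; exact (le_max_left _ _).trans ht)).1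
    have k2 := (h2 _ hre (by rw [him, abs_of_pos ht0]; exact (le_max_right _ _).trans ht)).2
    rw [him, abs_of_pos ht0] at k1 k2
    rw [h _ hne] at k1
    refine k1.trans ?_
    rw [mul_assoc]
    gcongr
  by_contra! hlt
  have hde : 0 < d - e := sub_pos.2 hlt
  have hk := key ((|B| + |B'| + 1) / (d - e)) (by positivity)
  have e1 : d * ((|B| + |B'| + 1) / (d - e)) - e * ((|B| + |B'| + 1) / (d - e))
      = |B| + |B'| + 1 := by field_simp
  linarith [le_abs_self B, le_abs_self B']

/-- Two continuations agree away from `1`, by the identity theorem after both polar factors are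
cleared. Used in both directions, this makes the degree unique. -/
lemma HasDegree.le {a : ArithmeticFunction ℂ} {d e : ℝ} (hd : HasDegree a d)
    (he : HasDegree a e) : d ≤ e := by
  obtain ⟨F, E, m, hF, hE, hEF, hg⟩ := hd
  obtain ⟨F', E', m', hF', hE', hEF', hg'⟩ := he
  refine hg.le hg' fun s hs => ?_
  have h1 : Differentiable ℂ fun z => (z - 1) ^ m' * E z :=
    ((differentiable_id.sub_const 1).pow m').mul hE
  have h2 : Differentiable ℂ fun z => (z - 1) ^ m * E' z :=
    ((differentiable_id.sub_const 1).pow m).mul hE'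
  have h := congrFun ((h1.differentiableOn.analyticOnNhd isOpen_univ).eq_of_eventuallyEq
    (h2.differentiableOn.analyticOnNhd isOpen_univ) (z₀ := 2) (by
      filter_upwards [(isOpen_lt continuous_const Complex.continuous_re).mem_nhds
        (show (1 : ℝ) < (2 : ℂ).re by norm_num)] with z hz
      have hz1 : z ≠ 1 := fun h0 => by
        have : (1 : ℝ) < z.re := hz
        rw [h0] at this
        norm_num at this
      rw [hEF z hz1, hEF' z hz1, hF z hz, hF' z hz]
      ring)) s
  simp only [hEF s hs, hEF' s hs] at h
  have hne := sub_ne_zero.2 hs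
  refine mul_left_cancel₀ (mul_ne_zero (pow_ne_zero m hne) (pow_ne_zero m' hne)) ?_
  linear_combination h

lemma HasLeftGrowth.mul {F G : ℂ → ℂ} {d e : ℝ} (hF : HasLeftGrowth F d)
    (hG : HasLeftGrowth G e) : HasLeftGrowth (fun s => F s * G s) (d + e) := by
  obtain ⟨B, hB⟩ := hF
  obtain ⟨B', hB'⟩ := hG
  refine ⟨B + B', fun c hc => ?_⟩
  obtain ⟨C, hC, T, hT, h1⟩ := hB c hc
  obtain ⟨C', hC', T', hT', h2⟩ := hB' c hc
  refine ⟨C * C', mul_pos hC hC', max T T', hT.trans (le_max_left _ _), fun s hs ht => ?_⟩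
  obtain ⟨k1, k2⟩ := h1 s hs ((le_max_left _ _).trans ht)
  obtain ⟨l1, l2⟩ := h2 s hs ((le_max_right _ _).trans ht)
  have ht0 : 0 < |s.im| := by linarith [(le_max_left T T').trans ht]
  rw [norm_mul]
  constructor
  · calc |s.im| ^ ((d + e) * c - (B + B')) = |s.im| ^ (d * c - B) * |s.im| ^ (e * c - B') := by
          rw [← Real.rpow_add ht0]; ring_nf
      _ ≤ (C * ‖F s‖) * (C' * ‖G s‖) := by gcongr
      _ = _ := by ring
  · calc ‖F s‖ * ‖G s‖ ≤ (C * |s.im| ^ (d * c + B)) * (C' * |s.im| ^ (e * c + B')) := by gcongr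
      _ = C * C' * (|s.im| ^ (d * c + B) * |s.im| ^ (e * c + B')) := by ring
      _ = _ := by rw [← Real.rpow_add ht0]; ring_nf

lemma HasDegree.mul {a b : ArithmeticFunction ℂ} {d e : ℝ} (ha : RamanujanBound a)
    (hb : RamanujanBound b) (hd : HasDegree a d) (he : HasDegree b e) :
    HasDegree (a * b) (d + e) := by
  obtain ⟨F, E, m, hF, hE, hEF, hg⟩ := hd
  obtain ⟨F', E', m', hF', hE', hEF', hg'⟩ := he
  refine ⟨fun s => F s * F' s, fun s => E s * E' s, m + m', fun s hs => ?_, hE.mul hE',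
    fun s hs => ?_, hg.mul hg'⟩
  · simp only
    rw [hF s hs, hF' s hs,
      ← ArithmeticFunction.LSeries_mul' (ha.summable hs) (hb.summable hs)]
  · simp only
    rw [hEF s hs, hEF' s hs, pow_add]
    ring

lemma exists_hasDegree {a : ArithmeticFunction ℂ} (ha : a ∈ selbergClass) (h1 : a ≠ 1) :
    ∃ d : ℝ, 1 ≤ d ∧ HasDegree a d := by
  obtain ⟨hR, hEu, F, hF, hcont, hfe⟩ := ha
  obtain ⟨d, hd, hg⟩ := (eq_one_or_exists_hasLeftGrowth hR hEu hF hcont hfe).resolve_left h1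
  obtain ⟨m, E, hE, -, hEF⟩ := hcont
  exact ⟨d, hd, F, E, m, hF, hE, hEF, hg⟩

/-- Every nontrivial element of the Selberg class is a product of primitive elements. -/
lemma exists_primitive_factorization {a : ArithmeticFunction ℂ} (ha : a ∈ selbergClass)
    (h1 : a ≠ 1) : ∃ l : List (ArithmeticFunction ℂ), (∀ P ∈ l, IsPrimitive P) ∧ l.prod = a := by
  -- Induction on an integer above the degree. In a nontrivial splitting the degrees add and each is
  -- at least `1`, so both factors fall below the previous bound.
  have main : ∀ (n : ℕ) (a : ArithmeticFunction ℂ), a ∈ selbergClass → a ≠ 1 →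
      ∀ d : ℝ, HasDegree a d → d < n →
      ∃ l : List (ArithmeticFunction ℂ), (∀ P ∈ l, IsPrimitive P) ∧ l.prod = a := by
    intro n
    induction n with
    | zero =>
      intro a ha h1 d hd hdn
      obtain ⟨e, he1, he⟩ := exists_hasDegree ha h1
      have := he.le hd
      simp at hdn
      linarith
    | succ n ih =>
      intro a ha h1 d hd hdn
      by_cases hp : IsPrimitive a
      · exact ⟨[a], by simpa using hp, by simp⟩
      · have : ∃ a₁ ∈ selbergClass, ∃ a₂ ∈ selbergClass, a = a₁ * a₂ ∧ a₁ ≠ 1 ∧ a₂ ≠ 1 := by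
          by_contra! hcon
          refine hp ⟨ha, h1, fun a₁ h₁ a₂ h₂ h => ?_⟩
          by_contra! hne
          exact hne.2 (hcon a₁ h₁ a₂ h₂ h hne.1)
        obtain ⟨a₁, ha₁, a₂, ha₂, rfl, hne₁, hne₂⟩ := this
        obtain ⟨d₁, hd₁, hdeg₁⟩ := exists_hasDegree ha₁ hne₁
        obtain ⟨d₂, hd₂, hdeg₂⟩ := exists_hasDegree ha₂ hne₂
        have hle := (hdeg₁.mul ha₁.1 ha₂.1 hdeg₂).le hd
        push_cast at hdn
        obtain ⟨l₁, hl₁, rfl⟩ := ih a₁ ha₁ hne₁ d₁ hdeg₁ (by linarith)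
        obtain ⟨l₂, hl₂, rfl⟩ := ih a₂ ha₂ hne₂ d₂ hdeg₂ (by linarith)
        refine ⟨l₁ ++ l₂, fun P hP => ?_, List.prod_append⟩
        exact (List.mem_append.1 hP).elim (hl₁ P) (hl₂ P)
  obtain ⟨d, -, hd⟩ := exists_hasDegree ha h1
  obtain ⟨n, hn⟩ := exists_nat_gt d
  exact main n a ha h1 d hd hn

/-! ### Prime sums and the orthonormality argument -/

lemma prod_apply_one {k : ℕ} {P : Fin k → ArithmeticFunction ℂ} (hP : ∀ i, P i 1 = 1)
    (s : Finset (Fin k)) : (∏ i ∈ s, P i) 1 = 1 := by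
  induction s using Finset.induction_on with
  | empty => simp
  | insert i s hi ih =>
    rw [Finset.prod_insert hi, ArithmeticFunction.mul_apply]
    simp [ih, hP]

lemma prod_apply_prime {k : ℕ} {P : Fin k → ArithmeticFunction ℂ} (hP : ∀ i, P i 1 = 1)
    (s : Finset (Fin k)) {p : ℕ} (hp : p.Prime) : (∏ i ∈ s, P i) p = ∑ i ∈ s, P i p := by
  induction s using Finset.induction_on with
  | empty => simp [ArithmeticFunction.one_apply_ne hp.one_lt.ne']
  | insert i s hi ih =>
    rw [Finset.prod_insert hi, Finset.sum_insert hi, ArithmeticFunction.mul_apply,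
      Nat.sum_divisorsAntidiagonal (f := fun x y => P i x * (∏ i ∈ s, P i) y),
      Nat.Prime.sum_divisors hp, Nat.div_self hp.pos, Nat.div_one, ih, hP, prod_apply_one hP]
    ring

/-- The pairing `∑_{p ≤ x} a_p conj(a'_p) / p` of Selberg's orthonormality conjecture. -/
noncomputable def primePairing (f g : ArithmeticFunction ℂ) (x : ℝ) : ℂ :=
  ∑ p ∈ Finset.range (⌊x⌋₊ + 1) with p.Prime, f p * conj (g p) / (p : ℂ)

/-- Density becomes the diagonal case of a sesquilinear pairing, which can be expanded over a
product. -/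
lemma hasPrimeDensity_iff {F : ArithmeticFunction ℂ} {n : ℤ} : HasPrimeDensity F n ↔
    (fun x : ℝ => primePairing F F x - (n : ℂ) * (Real.log (Real.log x) : ℂ))
      =O[atTop] fun _ => (1 : ℝ) := by
  rw [HasPrimeDensity, ← isBigO_norm_left, ← isBigO_norm_left (E' := ℂ)]
  refine iff_of_eq ?_
  congr 1
  funext x
  rw [← Complex.norm_real, primePairing]
  push_cast
  simp only [Complex.mul_conj']

/-- `log log x` is unbounded, so its coefficient is determined by an `O(1)` asymptotic. -/
lemma density_unique {f : ℝ → ℂ} {m n : ℤ}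
    (hm : (fun x : ℝ => f x - (m : ℂ) * (Real.log (Real.log x) : ℂ)) =O[atTop] fun _ => (1 : ℝ))
    (hn : (fun x : ℝ => f x - (n : ℂ) * (Real.log (Real.log x) : ℂ)) =O[atTop] fun _ => (1 : ℝ)) :
    m = n := by
  by_contra hne
  have hc : ((m - n : ℤ) : ℝ) ≠ 0 := by exact_mod_cast sub_ne_zero.2 hne
  have h : (fun x : ℝ => (((m - n : ℤ) : ℝ) * Real.log (Real.log x) : ℝ))
      =O[atTop] fun _ => (1 : ℝ) := by
    rw [← isBigO_norm_left]
    refine IsBigO.congr_left (hn.sub hm).norm_left fun x => ?_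
    rw [← Complex.norm_real]
    push_cast
    congr 1
    ring
  have h2 : (fun x : ℝ => Real.log (Real.log x)) =O[atTop] fun _ => (1 : ℝ) :=
    (isBigO_const_mul_left_iff hc).1 h
  have hlim : Tendsto (fun x : ℝ => Real.log (Real.log x)) atTop atTop :=
    Real.tendsto_log_atTop.comp Real.tendsto_log_atTop
  exact not_isBoundedUnder_of_tendsto_atTop (tendsto_norm_atTop_atTop.comp hlim)
    ((isBigO_one_iff ℝ).1 h2)

lemma ne_one_of_hasPrimeDensity_one {F : ArithmeticFunction ℂ} (hn : HasPrimeDensity F 1) :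
    F ≠ 1 := by
  rintro rfl
  have h0 : (fun x : ℝ => primePairing 1 1 x - ((0 : ℤ) : ℂ) * (Real.log (Real.log x) : ℂ))
      =O[atTop] fun _ => (1 : ℝ) := by
    have : ∀ x, primePairing 1 1 x = 0 := fun x => Finset.sum_eq_zero fun p hp => by
      rw [ArithmeticFunction.one_apply_ne (Finset.mem_filter.1 hp).2.one_lt.ne']
      simp
    simpa [this] using isBigO_zero (E' := ℂ) (fun _ : ℝ => (1 : ℝ)) atTop
  exact one_ne_zero (density_unique (hasPrimeDensity_iff.1 hn) h0)

lemma primePairing_prod {k : ℕ} {P : Fin k → ArithmeticFunction ℂ} (hP : ∀ i, P i 1 = 1) (x : ℝ) :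
    primePairing (∏ i, P i) (∏ i, P i) x = ∑ i, ∑ j, primePairing (P i) (P j) x := by
  simp only [primePairing]
  rw [Finset.sum_congr rfl fun i _ => Finset.sum_comm, Finset.sum_comm]
  refine Finset.sum_congr rfl fun p hp => ?_
  rw [prod_apply_prime hP _ (Finset.mem_filter.1 hp).2, map_sum, Finset.sum_mul_sum,
    Finset.sum_div]
  exact Finset.sum_congr rfl fun i _ => Finset.sum_div _ _ _

/-- A product of `k` primitive functions has prime density `1` only if `k = 1`. -/
lemma card_eq_one_of_hasPrimeDensity_one (hreg : RegularityConjecture)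
    (horth : OrthonormalityConjecture) {k : ℕ} {P : Fin k → ArithmeticFunction ℂ}
    (hP : ∀ i, IsPrimitive (P i)) (hn : HasPrimeDensity (∏ i, P i) 1) : k = 1 := by
  classical
  choose n hdens using fun i => hreg (P i) (hP i).1
  have hpair : ∀ i j, (fun x : ℝ => primePairing (P i) (P j) x -
      ((if P i = P j then n i else 0 : ℤ) : ℂ) * (Real.log (Real.log x) : ℂ))
        =O[atTop] fun _ => (1 : ℝ) := by
    intro i j
    split_ifs with h
    · rw [← h]
      exact hasPrimeDensity_iff.1 (hdens i)
    · simpa [primePairing] using (horth (P i) (P j) (hP i) (hP j) h).2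
  have hsum := IsBigO.sum fun i (_ : i ∈ Finset.univ) =>
    IsBigO.sum fun j (_ : j ∈ Finset.univ) => hpair i j
  have htot : (1 : ℤ) = ∑ i, ∑ j, if P i = P j then n i else 0 := by
    refine density_unique (hasPrimeDensity_iff.1 hn) (hsum.congr_left fun x => ?_)
    rw [primePairing_prod fun i => (hP i).1.2.1.1]
    push_cast
    simp only [Finset.sum_apply, Finset.sum_sub_distrib, Finset.sum_mul]
  -- Orthonormality yields `n = 1` for a primitive element only in the presence of a second,
  -- distinct one. When all factors agree, only the integer from regularity is available, and `1 =
  -- k² n` still forces `k = 1`.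
  by_cases hall : ∀ i j, P i = P j
  · have hk : k ≠ 0 := by
      rintro rfl
      simp at htot
    set i₀ : Fin k := ⟨0, Nat.pos_of_ne_zero hk⟩
    have hni : ∀ i, n i = n i₀ := fun i => density_unique
      (hasPrimeDensity_iff.1 (hdens i)) (by rw [hall i i₀]; exact hasPrimeDensity_iff.1 (hdens i₀))
    have hval : ∀ i j, (if P i = P j then n i else 0) = n i₀ := fun i j => by
      rw [if_pos (hall i j), hni]
    simp only [hval, Finset.sum_const, Finset.card_univ, Fintype.card_fin, nsmul_eq_mul] at htot
    have : (k : ℤ) ∣ 1 := ⟨_, htot⟩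
    exact_mod_cast Int.eq_one_of_dvd_one (Int.natCast_nonneg k) this
  · push Not at hall
    obtain ⟨i₁, i₂, hne⟩ := hall
    have hone : ∀ i, n i = 1 := fun i => by
      obtain ⟨j, hj⟩ : ∃ j, P i ≠ P j := by
        by_contra! h
        exact hne ((h i₁).symm.trans (h i₂))
      exact density_unique (hasPrimeDensity_iff.1 (hdens i))
        (hasPrimeDensity_iff.1 (horth (P i) (P j) (hP i) (hP j) hj).1)
    have hle : (k : ℤ) ≤ 1 := by
      rw [htot]
      calc (k : ℤ) = ∑ _i : Fin k, (1 : ℤ) := by simp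
        -- In each row the entry `j = i` contributes `1` and the others are nonnegative.
        _ ≤ _ := Finset.sum_le_sum fun i _ => by
            refine le_trans (by simp [hone]) (Finset.single_le_sum (a := i)
              (f := fun j => if P i = P j then n i else 0) (fun j _ => ?_) (Finset.mem_univ i))
            simp only [hone]
            split_ifs <;> norm_num
    have h2 : k ≤ 1 := by exact_mod_cast hle
    have h3 := i₁.pos
    omega

end Selberg

theorem proposition4p2
    (hreg : Selberg.RegularityConjecture)
    (horth : Selberg.OrthonormalityConjecture)
    (F : ArithmeticFunction ℂ) (hF : F ∈ Selberg.selbergClass)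
    (hn : Selberg.HasPrimeDensity F 1) :
    Selberg.IsPrimitive F := by
  obtain ⟨l, hl, rfl⟩ := Selberg.exists_primitive_factorization hF
    (Selberg.ne_one_of_hasPrimeDensity_one hn)
  have hprod : l.prod = ∏ i : Fin l.length, l.get i := by
    rw [← List.prod_ofFn, List.ofFn_get]
  have hlen : l.length = 1 :=
    Selberg.card_eq_one_of_hasPrimeDensity_one hreg horth (fun i => hl _ (l.get_mem i))
      (by rwa [← hprod])
  obtain ⟨P, rfl⟩ := List.length_eq_one_iff.1 hlen
  simpa using hl P (by simp)
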